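/- Let $G$ be a semigroup with identity and let $k$ be a $G$-field, i.e. a field with a homomorphism of monoids $G\to\operatorname{End}(k)$. A $k$-$G$-algebra is a commutative $k$-algebra $R$ with a homomorphism of monoids $G\to\operatorname{End}(R)$ into its ring endomorphisms such that $k\to R$ commutes with the actions of $G$; morphisms are the $k$-algebra homomorphisms commuting with $G$. A group $k$-$G$-scheme is a functor from $k$-$G$-algebras to groups that is representable by a $k$-$G$-algebra. Let $H$ be a group $k$-$G$-scheme. A representation of $H$ is a finite-dimensional $k$-vector space $V$ with a morphism of group functors $H\to\operatorname{GL}(V)$, where $\operatorname{GL}(V)(R)=\operatorname{Aut}_R(V\otimes_k R)$; morphisms of representations are the $H$-equivariant $k$-linear maps. This gives a category $\mathsf{Rep}(H)$. It has the tensor product $V\otimes_k W$, on which $h\in H(R)$ acts as $h\otimes h$, and the unit object $\mathbb 1=k$ with trivial action. For $g\in G$ and a module $M$ over a $G$-ring $A$, let ${}^gM=M\otimes_A A$ be the base extension via $g\colon A\to A$. Then $G$ acts on $\mathsf{Rep}(H)$ by $V\mapsto{}^gV$, where $h\in H(R)$ acts on ${}^gV\otimes_kR$ as ${}^gh$ through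 the canonical isomorphism ${}^gV\otimes_k R\simeq{}^g(V\otimes_k R)$. Let $\omega\colon\mathsf{Rep}(H)\to\mathsf{Vect}_k$ be the forgetful $G$-$\otimes$-functor. For a $k$-$G$-algebra $R$, let $\underline{\operatorname{Aut}}^{G,\otimes}(\omega)(R)$ be the group of automorphisms of the $G$-$\otimes$-functor $\omega\otimes R\colon V\mapsto V\otimes_kR$ from $\mathsf{Rep}(H)$ to $R$-modules, i.e. of the families of $R$-linear automorphisms $\beta_V$ of $V\otimes_kR$ that are natural in $V\in\mathsf{Rep}(H)$, satisfy $\beta_{V\otimes W}=\beta_V\otimes_R\beta_W$ and $\beta_{\mathbb 1}=\mathrm{id}$ under the canonical identifications, and for which $\beta_{{}^gV}$ corresponds to ${}^g(\beta_V)$ under ${}^gV\otimes_kR\simeq{}^g(V\otimes_kR)$ for all $g\in G$ and all $V$. By base change along morphisms $R\to S$, $\underline{\operatorname{Aut}}^{G,\otimes}(\omega)$ is a functor from $k$-$G$-algebras to groups. Then the canonical morphism $H\to\underline{\operatorname{Aut}}^{G,\otimes}(\omega)$, sending $h\in H(R)$ to the family of its actions on the modules $V\otimes_kR$, is an isomorphism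 of group functors on $k$-$G$-algebras. -/

import Mathlib

open CategoryTheory
open scoped TensorProduct

universe u v

noncomputable section

namespace GTannaka

/-! ## `G`-rings and `k`-`G`-algebras

`G` is a monoid (a semigroup with identity).  A `G`-ring is a commutative ring `A` with a
`MulSemiringAction G A`, which is the same thing as a monoid homomorphism `G → End(A)`. -/

/-- A `k`-`G`-algebra: a commutative `k`-algebra which is a `G`-ring, such that the structure map
`k → R` commutes with the action of `G`. -/
structure GAlg (G : Type v) [Monoid G] (k : Type u) [Field k] [MulSemiringAction G k] where
  carrier : Type u
  [commRing : CommRing carrier]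
  [algebra : Algebra k carrier]
  [action : MulSemiringAction G carrier]
  smul_algebraMap : ∀ (g : G) (a : k),
    g • algebraMap k carrier a = algebraMap k carrier (g • a)

attribute [instance] GAlg.commRing GAlg.algebra GAlg.action

instance (G : Type v) [Monoid G] (k : Type u) [Field k] [MulSemiringAction G k] :
    CoeSort (GAlg.{u, v} G k) (Type u) := ⟨GAlg.carrier⟩

section

variable {G : Type v} [Monoid G] {k : Type u} [Field k] [MulSemiringAction G k]

/-- Morphisms of `k`-`G`-algebras: `k`-algebra homomorphisms commuting with `G`. -/
@[ext]
structure GAlg.Hom (R S : GAlg G k) where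
  toAlgHom : R →ₐ[k] S
  map_smul : ∀ (g : G) (r : R), toAlgHom (g • r) = g • toAlgHom r

/-- The category of `k`-`G`-algebras. -/
instance : Category (GAlg G k) where
  Hom := GAlg.Hom
  id R := ⟨AlgHom.id k R, fun _ _ => rfl⟩
  comp f f' := ⟨f'.toAlgHom.comp f.toAlgHom, fun g r => by
    simp [f.map_smul, f'.map_smul]⟩

@[simp] lemma GAlg.id_toAlgHom (R : GAlg G k) : GAlg.Hom.toAlgHom (𝟙 R) = AlgHom.id k R := rfl

@[simp] lemma GAlg.comp_toAlgHom {R S T : GAlg G k} (f : R ⟶ S) (f' : S ⟶ T) :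
    GAlg.Hom.toAlgHom (f ≫ f') = (GAlg.Hom.toAlgHom f').comp (GAlg.Hom.toAlgHom f) := rfl

end

/-! ## Extension of scalars along an algebra homomorphism -/

section

variable {k : Type u} [Field k]
variable {R S T : Type u} [CommRing R] [Algebra k R] [CommRing S] [Algebra k S]
  [CommRing T] [Algebra k T]
variable {V W U : Type u} [AddCommGroup V] [Module k V] [AddCommGroup W] [Module k W]
  [AddCommGroup U] [Module k U]

/-- `φ ⊗ id : R ⊗ V → S ⊗ V`. -/
def push (φ : R →ₐ[k] S) (V : Type u) [AddCommGroup V] [Module k V] :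
    R ⊗[k] V →ₗ[k] S ⊗[k] V := φ.toLinearMap.rTensor V

@[simp] lemma push_tmul (φ : R →ₐ[k] S) (r : R) (v : V) :
    push φ V (r ⊗ₜ v) = φ r ⊗ₜ v := rfl

lemma push_smul (φ : R →ₐ[k] S) (r : R) (x : R ⊗[k] V) :
    push φ V (r • x) = φ r • push φ V x := by
  induction x with
  | zero => simp
  | add x y hx hy => simp only [smul_add, map_add, hx, hy]
  | tmul a v => simp [TensorProduct.smul_tmul']

/-- For an `R`-linear map `h : R ⊗ V → R ⊗ W`, the base change
`S ⊗ V = S ⊗_R (R ⊗ V) → S ⊗_R (R ⊗ W) = S ⊗ W`, i.e. the `S`-linear map with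
`1 ⊗ v ↦ (φ ⊗ id) (h (1 ⊗ v))`. -/
def extend (φ : R →ₐ[k] S) (h : R ⊗[k] V →ₗ[R] R ⊗[k] W) : S ⊗[k] V →ₗ[S] S ⊗[k] W :=
  LinearMap.liftBaseChange S
    (push φ W ∘ₗ h.restrictScalars k ∘ₗ TensorProduct.mk k R V 1)

lemma extend_one_tmul (φ : R →ₐ[k] S) (h : R ⊗[k] V →ₗ[R] R ⊗[k] W) (v : V) :
    extend φ h (1 ⊗ₜ v) = push φ W (h (1 ⊗ₜ v)) := by
  simp [extend]

lemma extend_push (φ : R →ₐ[k] S) (h : R ⊗[k] V →ₗ[R] R ⊗[k] W) (x : R ⊗[k] V) :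
    extend φ h (push φ V x) = push φ W (h x) := by
  induction x with
  | zero => simp
  | add x y hx hy => simp only [map_add, hx, hy]
  | tmul r v =>
    have h1 : (r ⊗ₜ v : R ⊗[k] V) = r • (1 ⊗ₜ v) := by simp [TensorProduct.smul_tmul']
    rw [h1, push_smul, map_smul, map_smul, push_smul, push_tmul, map_one, extend_one_tmul]

lemma linearMap_ext {M : Type*} [AddCommGroup M] [Module R M]
    {f f' : R ⊗[k] V →ₗ[R] M} (h : ∀ v : V, f (1 ⊗ₜ v) = f' (1 ⊗ₜ v)) : f = f' := by
  let _ : Module k M := Module.compHom M (algebraMap k R)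
  have _ : IsScalarTower k R M := ⟨fun a r m => by
    rw [Algebra.smul_def, mul_smul]; rfl⟩
  ext v
  exact h v

lemma extend_unique (φ : R →ₐ[k] S) (h : R ⊗[k] V →ₗ[R] R ⊗[k] W)
    (h' : S ⊗[k] V →ₗ[S] S ⊗[k] W)
    (H : ∀ v : V, h' (1 ⊗ₜ v) = push φ W (h (1 ⊗ₜ v))) : extend φ h = h' :=
  linearMap_ext fun v => by rw [extend_one_tmul, H]

lemma extend_comp (φ : R →ₐ[k] S) (h' : R ⊗[k] W →ₗ[R] R ⊗[k] U)
    (h : R ⊗[k] V →ₗ[R] R ⊗[k] W) : extend φ (h' ∘ₗ h) = extend φ h' ∘ₗ extend φ h :=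
  extend_unique _ _ _ fun v => by
    rw [LinearMap.comp_apply, extend_one_tmul, extend_push, LinearMap.comp_apply]

lemma extend_id (φ : R →ₐ[k] S) :
    extend φ (LinearMap.id : R ⊗[k] V →ₗ[R] R ⊗[k] V) = LinearMap.id :=
  extend_unique _ _ _ fun v => by simp

lemma extend_algHom_id (h : R ⊗[k] V →ₗ[R] R ⊗[k] W) : extend (AlgHom.id k R) h = h :=
  extend_unique _ _ _ fun v => by
    have : push (AlgHom.id k R) W = LinearMap.id := by ext; simp
    rw [this]; rfl

lemma extend_algHom_comp (φ : R →ₐ[k] S) (ψ : S →ₐ[k] T) (h : R ⊗[k] V →ₗ[R] R ⊗[k] W) :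
    extend (ψ.comp φ) h = extend ψ (extend φ h) :=
  extend_unique _ _ _ fun v => by
    have : push (ψ.comp φ) W = push ψ W ∘ₗ push φ W := by ext; simp
    rw [extend_one_tmul, extend_one_tmul, this]; rfl

/-- The base change of `R`-linear automorphisms of `R ⊗ V` along `φ : R → S`. -/
def extendAut (φ : R →ₐ[k] S) (V : Type u) [AddCommGroup V] [Module k V] :
    ((R ⊗[k] V) ≃ₗ[R] (R ⊗[k] V)) →* ((S ⊗[k] V) ≃ₗ[S] (S ⊗[k] V)) where
  toFun h := LinearEquiv.ofLinearMap (extend φ h.toLinearMap) (extend φ h.symm.toLinearMap)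
    (by rw [← extend_comp, LinearEquiv.comp_symm, extend_id])
    (by rw [← extend_comp, LinearEquiv.symm_comp, extend_id])
  map_one' := LinearEquiv.toLinearMap_injective (extend_id φ)
  map_mul' h h' := LinearEquiv.toLinearMap_injective (extend_comp φ h.toLinearMap h'.toLinearMap)

@[simp] lemma extendAut_toLinearMap (φ : R →ₐ[k] S) (h : (R ⊗[k] V) ≃ₗ[R] (R ⊗[k] V)) :
    (extendAut φ V h).toLinearMap = extend φ h.toLinearMap := rfl

end

/-! ## Base change along `g : A → A` -/

/-- A copy of the ring `A`, regarded as an `A`-algebra via `g : A → A`. -/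
def TwistRing {G : Type v} (_g : G) (A : Type u) : Type u := A

section

variable {G : Type v} [Monoid G] {A : Type u} [CommRing A] [MulSemiringAction G A]

instance (g : G) : CommRing (TwistRing g A) := inferInstanceAs (CommRing A)

instance (g : G) : Algebra A (TwistRing g A) := (MulSemiringAction.toRingHom G A g).toAlgebra

lemma TwistRing.smul_def (g : G) (a : A) (b : TwistRing g A) :
    a • b = ((g • a : A) * (show A from b) : A) := rfl

/-- `ᵍM = A ⊗_A M`, where the left factor `A` is an `A`-algebra via `g : A → A`; so
`r ⊗ s • m = (r * g(s)) ⊗ m`. -/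
def Twist (g : G) (A : Type u) [CommRing A] [MulSemiringAction G A]
    (M : Type u) [AddCommGroup M] [Module A M] : Type u := TwistRing g A ⊗[A] M

variable {M N P : Type u} [AddCommGroup M] [Module A M] [AddCommGroup N] [Module A N]
  [AddCommGroup P] [Module A P]

instance (g : G) : AddCommGroup (Twist g A M) :=
  inferInstanceAs (AddCommGroup (TwistRing g A ⊗[A] M))

/-- `A` acts on `ᵍM = A ⊗_A M` through the factor `A`: `s • (r ⊗ m) = (s * r) ⊗ m`. -/
instance (g : G) : Module A (Twist g A M) :=
  inferInstanceAs (Module (TwistRing g A) (TwistRing g A ⊗[A] M))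

instance (g : G) [Module.Finite A M] : Module.Finite A (Twist g A M) :=
  inferInstanceAs (Module.Finite (TwistRing g A) (TwistRing g A ⊗[A] M))

/-- The element `a ⊗ m` of `ᵍM`. -/
def Twist.tmul (g : G) (a : A) (m : M) : Twist g A M := (show TwistRing g A from a) ⊗ₜ[A] m

lemma Twist.smul_tmul (g : G) (a b : A) (m : M) :
    a • Twist.tmul g b m = Twist.tmul g (a * b) m := rfl

lemma Twist.tmul_smul (g : G) (a b : A) (m : M) :
    Twist.tmul g a (b • m) = Twist.tmul g (a * g • b) m := by
  unfold Twist.tmul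
  rw [← TensorProduct.smul_tmul]
  congr 1
  rw [TwistRing.smul_def]
  exact mul_comm _ _

lemma Twist.tmul_add (g : G) (a : A) (m m' : M) :
    Twist.tmul g a (m + m') = Twist.tmul g a m + Twist.tmul g a m' :=
  TensorProduct.tmul_add _ _ _

lemma Twist.add_tmul (g : G) (a a' : A) (m : M) :
    Twist.tmul g (a + a') m = Twist.tmul g a m + Twist.tmul g a' m :=
  TensorProduct.add_tmul _ _ _

lemma Twist.tmul_eq (g : G) (a : A) (m : M) :
    Twist.tmul g a m = a • Twist.tmul g 1 m := by
  rw [Twist.smul_tmul, mul_one]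

@[elab_as_elim]
lemma Twist.induction {g : G} {p : Twist g A M → Prop} (x : Twist g A M)
    (zero : p 0) (tmul : ∀ (a : A) (m : M), p (Twist.tmul g a m))
    (add : ∀ x y, p x → p y → p (x + y)) : p x :=
  TensorProduct.induction_on (motive := p) x zero tmul add

/-- The additive map on `ᵍM` defined by a map additive in both variables which is balanced with
respect to `g`. -/
def Twist.liftAdd {Q : Type*} [AddCommGroup Q] (g : G) (f : A →+ M →+ Q)
    (hf : ∀ (a b : A) (m : M), f (a * g • b) m = f a (b • m)) : Twist g A M →+ Q :=
  TensorProduct.liftAddHom (M := TwistRing g A) f (fun b a m =>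
    (DFunLike.congr_fun (congrArg f (mul_comm (g • b) (show A from a))) m).trans (hf a b m))

@[simp] lemma Twist.liftAdd_tmul {Q : Type*} [AddCommGroup Q] (g : G) (f : A →+ M →+ Q)
    (hf : ∀ (a b : A) (m : M), f (a * g • b) m = f a (b • m)) (a : A) (m : M) :
    Twist.liftAdd g f hf (Twist.tmul g a m) = f a m := rfl

/-- The base change `ᵍf = id ⊗ f : ᵍM → ᵍN` of an `A`-linear map `f : M → N`. -/
def Twist.map (g : G) (f : M →ₗ[A] N) : Twist g A M →ₗ[A] Twist g A N :=
  (f.baseChange (TwistRing g A) : TwistRing g A ⊗[A] M →ₗ[TwistRing g A] TwistRing g A ⊗[A] N)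

@[simp] lemma Twist.map_tmul (g : G) (f : M →ₗ[A] N) (a : A) (m : M) :
    Twist.map g f (Twist.tmul g a m) = Twist.tmul g a (f m) := rfl

lemma Twist.map_comp (g : G) (f' : N →ₗ[A] P) (f : M →ₗ[A] N) :
    Twist.map g (f' ∘ₗ f) = Twist.map g f' ∘ₗ Twist.map g f := by
  ext x
  induction x using Twist.induction with
  | zero => simp
  | tmul a m => simp
  | add x y hx hy => simp only [map_add, hx, hy]

lemma Twist.map_id (g : G) :
    Twist.map g (LinearMap.id : M →ₗ[A] M) = LinearMap.id := by
  ext x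
  induction x using Twist.induction with
  | zero => simp
  | tmul a m => simp
  | add x y hx hy => simp only [map_add, hx, hy]

/-- `ᵍh` for an automorphism `h`. -/
def Twist.mapAut (g : G) : (M ≃ₗ[A] M) →* (Twist g A M ≃ₗ[A] Twist g A M) where
  toFun h := LinearEquiv.ofLinearMap (Twist.map g h.toLinearMap) (Twist.map g h.symm.toLinearMap)
    (by rw [← Twist.map_comp, LinearEquiv.comp_symm, Twist.map_id])
    (by rw [← Twist.map_comp, LinearEquiv.symm_comp, Twist.map_id])
  map_one' := LinearEquiv.toLinearMap_injective (Twist.map_id g)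
  map_mul' h h' :=
    LinearEquiv.toLinearMap_injective (Twist.map_comp g h.toLinearMap h'.toLinearMap)

end

/-! ## The isomorphism `R ⊗ ᵍV ≃ ᵍ(R ⊗ V)` -/

section

variable {G : Type v} [Monoid G] {k : Type u} [Field k] [MulSemiringAction G k]

/-- The `k`-linear-over-`k → R` map `ᵍV → ᵍ(R ⊗ V)`, `a ⊗ v ↦ a ⊗ (1 ⊗ v)`. -/
def twistIsoAux (R : GAlg G k) (V : Type u) [AddCommGroup V] [Module k V] (g : G) :
    Twist g k V →+ Twist g R (R ⊗[k] V) :=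
  Twist.liftAdd g
    { toFun := fun a =>
        { toFun := fun v => Twist.tmul g (algebraMap k R a) (1 ⊗ₜ[k] v)
          map_zero' := by rw [TensorProduct.tmul_zero]; exact TensorProduct.tmul_zero _ _
          map_add' := fun v v' => by rw [TensorProduct.tmul_add, Twist.tmul_add] }
      map_zero' := by ext v; simp only [map_zero]; exact TensorProduct.zero_tmul _ _
      map_add' := fun a b => by ext v; simp [Twist.add_tmul] }
    (fun a b v => by
      have h : (1 ⊗ₜ[k] (b • v) : R ⊗[k] V) = algebraMap k R b • (1 ⊗ₜ[k] v) := by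
        rw [TensorProduct.tmul_smul, algebraMap_smul]
      simp only [AddMonoidHom.coe_mk, ZeroHom.coe_mk]
      rw [h, Twist.tmul_smul, R.smul_algebraMap, map_mul])

@[simp] lemma twistIsoAux_tmul (R : GAlg G k) (V : Type u) [AddCommGroup V] [Module k V] (g : G)
    (a : k) (v : V) :
    twistIsoAux R V g (Twist.tmul g a v) = Twist.tmul g (algebraMap k R a) (1 ⊗ₜ[k] v) := rfl

lemma twistIsoAux_smul (R : GAlg G k) (V : Type u) [AddCommGroup V] [Module k V] (g : G)
    (a : k) (x : Twist g k V) :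
    twistIsoAux R V g (a • x) = algebraMap k R a • twistIsoAux R V g x := by
  induction x using Twist.induction with
  | zero => simp
  | tmul b v => simp [Twist.smul_tmul]
  | add x y hx hy => simp only [smul_add, map_add, hx, hy]

/-- The canonical map `R ⊗ ᵍV → ᵍ(R ⊗ V)`, `r ⊗ (a ⊗ v) ↦ (r * a) ⊗ (1 ⊗ v)`. -/
def twistIsoHom (R : GAlg G k) (V : Type u) [AddCommGroup V] [Module k V] (g : G) :
    R ⊗[k] Twist g k V →ₗ[R] Twist g R (R ⊗[k] V) :=
  { TensorProduct.liftAddHom (R := k)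
      (((smulAddHom R (Twist g R (R ⊗[k] V))).flip.comp (twistIsoAux R V g)).flip)
      (fun a r x => by
        simp only [AddMonoidHom.flip_apply, AddMonoidHom.comp_apply, smulAddHom_apply,
          twistIsoAux_smul, Algebra.smul_def]
        rw [mul_comm, mul_smul]) with
    map_smul' := fun s x => by
      simp only [ZeroHom.toFun_eq_coe, AddMonoidHom.toZeroHom_coe, RingHom.id_apply]
      induction x with
      | zero => simp
      | add x y hx hy => simp only [smul_add, map_add, hx, hy]
      | tmul r x => simp [TensorProduct.smul_tmul', mul_smul] }

@[simp] lemma twistIsoHom_tmul (R : GAlg G k) (V : Type u) [AddCommGroup V] [Module k V] (g : G)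
    (r : R) (a : k) (v : V) :
    twistIsoHom R V g (r ⊗ₜ Twist.tmul g a v) =
      Twist.tmul g (r * algebraMap k R a) (1 ⊗ₜ[k] v) := rfl

/-- The `g`-semilinear map `R ⊗ V → R ⊗ ᵍV`, `s ⊗ v ↦ g(s) ⊗ (1 ⊗ v)`. -/
def twistIsoInvAux (R : GAlg G k) (V : Type u) [AddCommGroup V] [Module k V] (g : G) :
    R ⊗[k] V →+ R ⊗[k] Twist g k V :=
  TensorProduct.liftAddHom (R := k)
    { toFun := fun s =>
        { toFun := fun v => (g • s) ⊗ₜ[k] Twist.tmul g 1 v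
          map_zero' := by
            rw [show Twist.tmul g (1 : k) (0 : V) = 0 from TensorProduct.tmul_zero _ _,
              TensorProduct.tmul_zero]
          map_add' := fun v v' => by rw [Twist.tmul_add, TensorProduct.tmul_add] }
      map_zero' := by ext v; simp
      map_add' := fun s s' => by ext v; simp [TensorProduct.add_tmul] }
    (fun a s v => by
      simp only [AddMonoidHom.coe_mk, ZeroHom.coe_mk]
      rw [Twist.tmul_smul, one_mul, Twist.tmul_eq g (g • a), ← TensorProduct.smul_tmul,
        Algebra.smul_def, Algebra.smul_def, smul_mul', R.smul_algebraMap])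

@[simp] lemma twistIsoInvAux_tmul (R : GAlg G k) (V : Type u) [AddCommGroup V] [Module k V]
    (g : G) (s : R) (v : V) :
    twistIsoInvAux R V g (s ⊗ₜ v) = (g • s) ⊗ₜ[k] Twist.tmul g 1 v := rfl

lemma twistIsoInvAux_smul (R : GAlg G k) (V : Type u) [AddCommGroup V] [Module k V]
    (g : G) (s : R) (x : R ⊗[k] V) :
    twistIsoInvAux R V g (s • x) = (g • s) • twistIsoInvAux R V g x := by
  induction x with
  | zero => simp
  | add x y hx hy => simp only [smul_add, map_add, hx, hy]
  | tmul r v => simp [TensorProduct.smul_tmul']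

/-- The canonical map `ᵍ(R ⊗ V) → R ⊗ ᵍV`, `r ⊗ (s ⊗ v) ↦ (r * g(s)) ⊗ (1 ⊗ v)`. -/
def twistIsoInv (R : GAlg G k) (V : Type u) [AddCommGroup V] [Module k V] (g : G) :
    Twist g R (R ⊗[k] V) →ₗ[R] R ⊗[k] Twist g k V :=
  { Twist.liftAdd g
      (((smulAddHom R (R ⊗[k] Twist g k V)).flip.comp (twistIsoInvAux R V g)).flip)
      (fun r s x => by
        simp only [AddMonoidHom.flip_apply, AddMonoidHom.comp_apply, smulAddHom_apply,
          twistIsoInvAux_smul, mul_smul]) with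
    map_smul' := fun s x => by
      simp only [ZeroHom.toFun_eq_coe, AddMonoidHom.toZeroHom_coe, RingHom.id_apply]
      induction x using Twist.induction with
      | zero => simp
      | add x y hx hy => simp only [smul_add, map_add, hx, hy]
      | tmul r x => simp [Twist.smul_tmul, mul_smul] }

lemma twistIsoInv_tmul (R : GAlg G k) (V : Type u) [AddCommGroup V] [Module k V] (g : G)
    (r : R) (x : R ⊗[k] V) :
    twistIsoInv R V g (Twist.tmul g r x) = r • twistIsoInvAux R V g x := rfl

/-- The canonical isomorphism `R ⊗ ᵍV ≃ ᵍ(R ⊗ V)` of `R`-modules,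
`r ⊗ (a ⊗ v) ↦ (r * a) ⊗ (1 ⊗ v)`, with inverse `r ⊗ (s ⊗ v) ↦ (r * g(s)) ⊗ (1 ⊗ v)`. -/
def twistIso (R : GAlg G k) (V : Type u) [AddCommGroup V] [Module k V] (g : G) :
    (R ⊗[k] Twist g k V) ≃ₗ[R] Twist g R (R ⊗[k] V) :=
  LinearEquiv.ofLinearMap (twistIsoHom R V g) (twistIsoInv R V g)
    (by
      ext x
      induction x using Twist.induction with
      | zero => simp
      | add x y hx hy => simp only [map_add, hx, hy]
      | tmul r x =>
        induction x with
        | zero =>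
          rw [show Twist.tmul g r (0 : R ⊗[k] V) = 0 from TensorProduct.tmul_zero _ _]
          simp
        | add x y hx hy => simp only [Twist.tmul_add, map_add, hx, hy]
        | tmul s v =>
          have h : (s ⊗ₜ[k] v : R ⊗[k] V) = s • (1 ⊗ₜ[k] v) := by
            simp [TensorProduct.smul_tmul']
          rw [LinearMap.comp_apply, twistIsoInv_tmul, twistIsoInvAux_tmul,
            TensorProduct.smul_tmul', twistIsoHom_tmul, h, Twist.tmul_smul]
          simp)
    (linearMap_ext fun x => by
      induction x using Twist.induction with
      | zero => simp
      | add x y hx hy => simp only [TensorProduct.tmul_add, map_add, hx, hy]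
      | tmul a v =>
        rw [LinearMap.comp_apply, twistIsoHom_tmul, twistIsoInv_tmul, twistIsoInvAux_tmul,
          TensorProduct.smul_tmul', Twist.tmul_eq g a, one_mul, smul_one, smul_eq_mul, mul_one,
          Algebra.algebraMap_eq_smul_one, TensorProduct.smul_tmul]
        rfl)

@[simp] lemma twistIso_tmul (R : GAlg G k) (V : Type u) [AddCommGroup V] [Module k V] (g : G)
    (r : R) (a : k) (v : V) :
    twistIso R V g (r ⊗ₜ Twist.tmul g a v) =
      Twist.tmul g (r * algebraMap k R a) (1 ⊗ₜ[k] v) := rfl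

@[simp] lemma twistIso_symm_tmul (R : GAlg G k) (V : Type u) [AddCommGroup V] [Module k V]
    (g : G) (r : R) (x : R ⊗[k] V) :
    (twistIso R V g).symm (Twist.tmul g r x) = r • twistIsoInvAux R V g x := rfl

/-! ## The functor `GL(V)` and morphisms between such functors -/

/-- The group functor `GL(V)` on `k`-`G`-algebras: `R ↦` the `R`-linear automorphisms of the
`R`-module `R ⊗ V`. -/
def glFunctor (G : Type v) [Monoid G] (k : Type u) [Field k] [MulSemiringAction G k]
    (V : Type u) [AddCommGroup V] [Module k V] : GAlg.{u, v} G k ⥤ GrpCat.{u} where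
  obj R := GrpCat.of ((R ⊗[k] V) ≃ₗ[R] (R ⊗[k] V))
  map φ := GrpCat.ofHom (extendAut φ.toAlgHom V)
  map_id R := by
    ext h : 2
    exact LinearEquiv.toLinearMap_injective (extend_algHom_id _)
  map_comp φ ψ := by
    ext h : 2
    exact LinearEquiv.toLinearMap_injective (extend_algHom_comp _ _ _)

/-- Conjugation by a linear equivalence, as a group homomorphism. -/
def conjAut {A : Type u} [CommRing A] {M N : Type u} [AddCommMonoid M] [Module A M]
    [AddCommMonoid N] [Module A N] (e : M ≃ₗ[A] N) : (N ≃ₗ[A] N) →* (M ≃ₗ[A] M) where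
  toFun h := e ≪≫ₗ h ≪≫ₗ e.symm
  map_one' := by ext x; simp
  map_mul' h h' := by ext x; simp

@[simp] lemma conjAut_apply {A : Type u} [CommRing A] {M N : Type u} [AddCommMonoid M]
    [Module A M] [AddCommMonoid N] [Module A N] (e : M ≃ₗ[A] N) (h : N ≃ₗ[A] N) (x : M) :
    conjAut e h x = e.symm (h (e x)) := rfl

lemma conjAut_eq_iff {A : Type u} [CommRing A] {M N : Type u} [AddCommMonoid M]
    [Module A M] [AddCommMonoid N] [Module A N] (e : M ≃ₗ[A] N) (h : N ≃ₗ[A] N)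
    (h' : M ≃ₗ[A] M) :
    e.toLinearMap ∘ₗ h'.toLinearMap = h.toLinearMap ∘ₗ e.toLinearMap ↔ h' = conjAut e h := by
  constructor
  · intro H
    ext x
    rw [conjAut_apply, LinearEquiv.eq_symm_apply]
    exact LinearMap.congr_fun H x
  · rintro rfl
    ext x
    simp

/-- The homomorphism `g : GL(V)(R) → GL(ᵍV)(R)`, sending `h` to
`R ⊗ ᵍV ≃ ᵍ(R ⊗ V) → ᵍ(R ⊗ V) ≃ R ⊗ ᵍV`, where the map in the middle is `ᵍh`. -/
def glTwist (R : GAlg G k) (V : Type u) [AddCommGroup V] [Module k V] (g : G) :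
    ((R ⊗[k] V) ≃ₗ[R] (R ⊗[k] V)) →*
      ((R ⊗[k] Twist g k V) ≃ₗ[R] (R ⊗[k] Twist g k V)) :=
  (conjAut (twistIso R V g)).comp (Twist.mapAut g)

lemma push_twistIsoInvAux {R S : GAlg G k} (φ : R ⟶ S) (V : Type u) [AddCommGroup V]
    [Module k V] (g : G) (x : R ⊗[k] V) :
    push φ.toAlgHom (Twist g k V) (twistIsoInvAux R V g x) =
      twistIsoInvAux S V g (push φ.toAlgHom V x) := by
  induction x with
  | zero => simp
  | add x y hx hy => simp only [map_add, hx, hy]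
  | tmul r v => simp [GAlg.Hom.map_smul]

lemma glTwist_one_tmul (R : GAlg G k) (V : Type u) [AddCommGroup V] [Module k V] (g : G)
    (h : (R ⊗[k] V) ≃ₗ[R] (R ⊗[k] V)) (a : k) (v : V) :
    glTwist R V g h (1 ⊗ₜ Twist.tmul g a v) =
      algebraMap k R a • twistIsoInvAux R V g (h (1 ⊗ₜ v)) := by
  change (twistIso R V g).symm
    (Twist.map g h.toLinearMap (twistIso R V g (1 ⊗ₜ Twist.tmul g a v))) = _
  rw [twistIso_tmul, Twist.map_tmul, twistIso_symm_tmul, one_mul]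
  rfl

lemma glTwist_natural {R S : GAlg G k} (φ : R ⟶ S) (V : Type u) [AddCommGroup V]
    [Module k V] (g : G) (h : (R ⊗[k] V) ≃ₗ[R] (R ⊗[k] V)) :
    extendAut φ.toAlgHom (Twist g k V) (glTwist R V g h) =
      glTwist S V g (extendAut φ.toAlgHom V h) := by
  refine LinearEquiv.toLinearMap_injective (extend_unique _ _ _ fun x => ?_)
  induction x using Twist.induction with
  | zero => simp
  | add x y hx hy => simp only [TensorProduct.tmul_add, map_add, hx, hy]
  | tmul a v =>
    rw [LinearEquiv.coe_coe, LinearEquiv.coe_coe, glTwist_one_tmul, glTwist_one_tmul, push_smul,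
      push_twistIsoInvAux, AlgHom.commutes]
    congr 2
    exact extend_one_tmul _ _ _

/-- The morphism of group functors `g : GL(V) → GL(ᵍV)`. -/
def glFunctorTwist (V : Type u) [AddCommGroup V] [Module k V] (g : G) :
    glFunctor G k V ⟶ glFunctor G k (Twist g k V) where
  app R := GrpCat.ofHom (glTwist R V g)
  naturality R S φ := by
    ext h : 2
    exact (glTwist_natural φ V g h).symm

/-- `h ⊗ h'` on `R ⊗ (V ⊗ W) ≃ (R ⊗ V) ⊗_R (R ⊗ W)`. -/
def glTensor (R : GAlg G k) (V W : Type u) [AddCommGroup V] [Module k V] [AddCommGroup W]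
    [Module k W] :
    ((R ⊗[k] V) ≃ₗ[R] (R ⊗[k] V)) × ((R ⊗[k] W) ≃ₗ[R] (R ⊗[k] W)) →*
      ((R ⊗[k] (V ⊗[k] W)) ≃ₗ[R] (R ⊗[k] (V ⊗[k] W))) :=
  (conjAut (TensorProduct.AlgebraTensorModule.distribBaseChange k R V W)).comp
    { toFun := fun p => TensorProduct.congr p.1 p.2
      map_one' := by
        apply LinearEquiv.toLinearMap_injective
        ext x y
        rfl
      map_mul' := fun p q => by
        apply LinearEquiv.toLinearMap_injective
        apply TensorProduct.ext'
        intro x y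
        rfl }

lemma glTensor_one_tmul (R : GAlg G k) (V W : Type u) [AddCommGroup V] [Module k V]
    [AddCommGroup W] [Module k W]
    (p : ((R ⊗[k] V) ≃ₗ[R] (R ⊗[k] V)) × ((R ⊗[k] W) ≃ₗ[R] (R ⊗[k] W))) (v : V) (w : W) :
    glTensor R V W p (1 ⊗ₜ (v ⊗ₜ w)) =
      (TensorProduct.AlgebraTensorModule.distribBaseChange k R V W).symm
        (p.1 (1 ⊗ₜ v) ⊗ₜ p.2 (1 ⊗ₜ w)) := rfl

lemma push_distrib_symm {R S : GAlg G k} (φ : R ⟶ S) (V W : Type u) [AddCommGroup V]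
    [Module k V] [AddCommGroup W] [Module k W] (x : R ⊗[k] V) (y : R ⊗[k] W) :
    push φ.toAlgHom (V ⊗[k] W)
        ((TensorProduct.AlgebraTensorModule.distribBaseChange k R V W).symm (x ⊗ₜ y)) =
      (TensorProduct.AlgebraTensorModule.distribBaseChange k S V W).symm
        (push φ.toAlgHom V x ⊗ₜ push φ.toAlgHom W y) := by
  induction x with
  | zero => simp
  | add x x' hx hx' => simp only [map_add, TensorProduct.add_tmul, hx, hx']
  | tmul r v =>
    induction y with
    | zero => simp
    | add y y' hy hy' => simp only [map_add, TensorProduct.tmul_add, hy, hy']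
    | tmul s w => simp

lemma glTensor_natural {R S : GAlg G k} (φ : R ⟶ S) (V W : Type u) [AddCommGroup V]
    [Module k V] [AddCommGroup W] [Module k W]
    (h : (R ⊗[k] V) ≃ₗ[R] (R ⊗[k] V)) (h' : (R ⊗[k] W) ≃ₗ[R] (R ⊗[k] W)) :
    extendAut φ.toAlgHom (V ⊗[k] W) (glTensor R V W (h, h')) =
      glTensor S V W (extendAut φ.toAlgHom V h, extendAut φ.toAlgHom W h') := by
  refine LinearEquiv.toLinearMap_injective (extend_unique _ _ _ fun x => ?_)
  induction x with
  | zero => simp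
  | add x y hx hy => simp only [TensorProduct.tmul_add, map_add, hx, hy]
  | tmul v w =>
    rw [LinearEquiv.coe_coe, LinearEquiv.coe_coe, glTensor_one_tmul, glTensor_one_tmul,
      push_distrib_symm]
    congr 2
    · exact extend_one_tmul _ _ _
    · exact extend_one_tmul _ _ _

end

/-! ## Group `k`-`G`-schemes and their representations -/

section

variable {G : Type v} [Monoid G] {k : Type u} [Field k] [MulSemiringAction G k]

/-- A group functor on `k`-`G`-algebras is a group `k`-`G`-scheme if (its underlying set-valued
functor) is representable by a `k`-`G`-algebra. -/
abbrev IsGroupScheme (H : GAlg.{u, v} G k ⥤ GrpCat.{u}) : Prop :=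
  (H ⋙ forget GrpCat.{u}).IsCorepresentable

/-- A representation of `H`: a finite-dimensional `k`-vector space `V` with a morphism of group
functors `H → GL(V)`. -/
structure Rep (H : GAlg.{u, v} G k ⥤ GrpCat.{u}) where
  carrier : Type u
  [addCommGroup : AddCommGroup carrier]
  [module : Module k carrier]
  [finite : Module.Finite k carrier]
  φ : H ⟶ glFunctor G k carrier

attribute [instance] Rep.addCommGroup Rep.module Rep.finite

variable {H : GAlg.{u, v} G k ⥤ GrpCat.{u}}

instance : CoeSort (Rep H) (Type u) := ⟨Rep.carrier⟩

/-- The action of `h ∈ H(R)` on `R ⊗ V`. -/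
def Rep.act (V : Rep H) (R : GAlg G k) : H.obj R →* ((R ⊗[k] V) ≃ₗ[R] (R ⊗[k] V)) :=
  (V.φ.app R).hom

lemma Rep.act_map (V : Rep H) {R S : GAlg G k} (f : R ⟶ S) (h : H.obj R) :
    V.act S (H.map f h) = extendAut f.toAlgHom V (V.act R h) :=
  ConcreteCategory.congr_hom (V.φ.naturality f) h

/-- A morphism of representations: an `H`-equivariant `k`-linear map. -/
@[ext]
structure Rep.Hom (V W : Rep H) where
  toLinearMap : V →ₗ[k] W
  equivariant : ∀ (R : GAlg G k) (h : H.obj R),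
    toLinearMap.baseChange R ∘ₗ (V.act R h).toLinearMap =
      (W.act R h).toLinearMap ∘ₗ toLinearMap.baseChange R

/-- The category `Rep(H)`. -/
instance : Category (Rep H) where
  Hom := Rep.Hom
  id V := ⟨LinearMap.id, fun R h => by simp⟩
  comp f f' := ⟨f'.toLinearMap ∘ₗ f.toLinearMap, fun R h => by
    rw [LinearMap.baseChange_comp, LinearMap.comp_assoc, f.equivariant, ← LinearMap.comp_assoc,
      f'.equivariant, LinearMap.comp_assoc]⟩

/-- The tensor product of representations: `V ⊗ W` with `h` acting as `h ⊗ h`. -/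
def Rep.tensor (V W : Rep H) : Rep H where
  carrier := V ⊗[k] W
  φ :=
    { app := fun R => GrpCat.ofHom ((glTensor R V W).comp ((V.act R).prod (W.act R)))
      naturality := fun R S f => by
        ext h : 2
        exact (congrArg (glTensor S V W) (Prod.ext (V.act_map f h) (W.act_map f h))).trans
          (glTensor_natural f V W (V.act R h) (W.act R h)).symm }

/-- The unit representation: `k` with the trivial action of `H`. -/
def Rep.unit (H : GAlg.{u, v} G k ⥤ GrpCat.{u}) : Rep H where
  carrier := k
  φ :=
    { app := fun R => GrpCat.ofHom 1
      naturality := fun R S f => by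
        ext h : 2
        exact (map_one (extendAut f.toAlgHom k)).symm }

/-- The action of `g ∈ G` on `Rep(H)`: `ᵍV = k ⊗ V` (base change along `g : k → k`), with `H`
acting through `H → GL(V) → GL(ᵍV)`. -/
def Rep.twist (g : G) (V : Rep H) : Rep H where
  carrier := Twist g k V
  φ := V.φ ≫ glFunctorTwist V g

/-! ## The group functor of automorphisms of the forgetful `G`-`⊗`-functor -/

/-- A family of `R`-linear automorphisms `β_V` of `R ⊗ V`, indexed by the representations `V` of
`H`, is an automorphism of the `G`-`⊗`-functor `V ↦ R ⊗ V` from `Rep(H)` to `R`-modules if it is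
natural in `V`, compatible with tensor products and the unit object, and compatible with the
action of `G`. -/
structure IsGTensorAut (R : GAlg G k)
    (β : ∀ V : Rep H, (R ⊗[k] V) ≃ₗ[R] (R ⊗[k] V)) : Prop where
  naturality : ∀ {V W : Rep H} (f : V ⟶ W),
    f.toLinearMap.baseChange R ∘ₗ (β V).toLinearMap =
      (β W).toLinearMap ∘ₗ f.toLinearMap.baseChange R
  /-- The square with horizontal maps `R ⊗ (V ⊗ W) ≃ (R ⊗ V) ⊗_R (R ⊗ W)` and vertical maps
  `β_{V ⊗ W}` and `β_V ⊗ β_W` commutes. -/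
  tensor : ∀ V W : Rep H,
    (TensorProduct.AlgebraTensorModule.distribBaseChange k R V W).toLinearMap ∘ₗ
        (β (V.tensor W)).toLinearMap =
      TensorProduct.map (β V).toLinearMap (β W).toLinearMap ∘ₗ
        (TensorProduct.AlgebraTensorModule.distribBaseChange k R V W).toLinearMap
  /-- Under `R ⊗ k ≃ R`, `β` at the unit object is the identity. -/
  unit : (TensorProduct.AlgebraTensorModule.rid k R R).toLinearMap ∘ₗ
        (β (Rep.unit H)).toLinearMap =
      (TensorProduct.AlgebraTensorModule.rid k R R).toLinearMap
  /-- The square with horizontal maps `R ⊗ ᵍV ≃ ᵍ(R ⊗ V)` and vertical maps `β_{ᵍV}` and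
  `ᵍ(β_V)` commutes. -/
  twist : ∀ (g : G) (V : Rep H),
    (twistIso R V g).toLinearMap ∘ₗ (β (V.twist g)).toLinearMap =
      Twist.map g (β V).toLinearMap ∘ₗ (twistIso R V g).toLinearMap

lemma isGTensorAut_iff (R : GAlg G k)
    (β : ∀ V : Rep H, (R ⊗[k] V) ≃ₗ[R] (R ⊗[k] V)) :
    IsGTensorAut R β ↔
      (∀ {V W : Rep H} (f : V ⟶ W), f.toLinearMap.baseChange R ∘ₗ (β V).toLinearMap =
        (β W).toLinearMap ∘ₗ f.toLinearMap.baseChange R) ∧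
      (∀ V W : Rep H, β (V.tensor W) = glTensor R V W (β V, β W)) ∧
      β (Rep.unit H) = 1 ∧
      ∀ (g : G) (V : Rep H), β (V.twist g) = glTwist R V g (β V) := by
  have ht : ∀ V W : Rep H, _ := fun V W => conjAut_eq_iff
    (TensorProduct.AlgebraTensorModule.distribBaseChange k R V W)
    (TensorProduct.congr (β V) (β W)) (β (V.tensor W))
  have hg : ∀ (g : G) (V : Rep H), _ := fun g V => conjAut_eq_iff
    (twistIso R V g) (Twist.mapAut g (β V)) (β (V.twist g))
  have hu := conjAut_eq_iff (TensorProduct.AlgebraTensorModule.rid k R R) 1 (β (Rep.unit H))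
  rw [map_one] at hu
  constructor
  · intro h
    exact ⟨h.naturality, fun V W => (ht V W).1 (h.tensor V W), hu.1 h.unit,
      fun g V => (hg g V).1 (h.twist g V)⟩
  · rintro ⟨h1, h2, h3, h4⟩
    exact ⟨h1, fun V W => (ht V W).2 (h2 V W), hu.2 h3, fun g V => (hg g V).2 (h4 g V)⟩

/-- The group of automorphisms of the `G`-`⊗`-functor `V ↦ R ⊗ V` on `Rep(H)`. -/
def gTensorAut (H : GAlg.{u, v} G k ⥤ GrpCat.{u}) (R : GAlg G k) :
    Subgroup (∀ V : Rep H, (R ⊗[k] V) ≃ₗ[R] (R ⊗[k] V)) where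
  carrier := {β | IsGTensorAut R β}
  one_mem' := by
    refine (isGTensorAut_iff R _).2 ⟨fun f => rfl, fun V W => ?_, rfl, fun g V => ?_⟩
    · exact (map_one (glTensor R V W)).symm
    · exact (map_one (glTwist R V g)).symm
  mul_mem' := by
    intro β γ hβ hγ
    obtain ⟨b1, b2, b3, b4⟩ := (isGTensorAut_iff R _).1 hβ
    obtain ⟨c1, c2, c3, c4⟩ := (isGTensorAut_iff R _).1 hγ
    refine (isGTensorAut_iff R _).2 ⟨fun {V W} f => ?_, fun V W => ?_, ?_, fun g V => ?_⟩
    · change _ ∘ₗ ((β V).toLinearMap ∘ₗ (γ V).toLinearMap) =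
        ((β W).toLinearMap ∘ₗ (γ W).toLinearMap) ∘ₗ _
      rw [← LinearMap.comp_assoc, b1, LinearMap.comp_assoc, c1, LinearMap.comp_assoc]
    · exact (congrArg₂ (· * ·) (b2 V W) (c2 V W)).trans
        (map_mul (glTensor R V W) (β V, β W) (γ V, γ W)).symm
    · rw [Pi.mul_apply, b3, c3, one_mul]
    · exact (congrArg₂ (· * ·) (b4 g V) (c4 g V)).trans (map_mul (glTwist R V g) (β V) (γ V)).symm
  inv_mem' := by
    intro β hβ
    obtain ⟨b1, b2, b3, b4⟩ := (isGTensorAut_iff R _).1 hβ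
    refine (isGTensorAut_iff R _).2 ⟨fun {V W} f => ?_, fun V W => ?_, ?_, fun g V => ?_⟩
    · ext x
      have := LinearMap.congr_fun (b1 f) ((β V).symm (1 ⊗ₜ x))
      simp only [LinearMap.comp_apply, LinearEquiv.coe_coe, LinearEquiv.apply_symm_apply] at this
      change f.toLinearMap.baseChange R ((β V).symm (1 ⊗ₜ x)) =
        (β W).symm (f.toLinearMap.baseChange R (1 ⊗ₜ x))
      rw [this, LinearEquiv.symm_apply_apply]
    · exact (congrArg (·⁻¹) (b2 V W)).trans (map_inv (glTensor R V W) (β V, β W)).symm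
    · rw [Pi.inv_apply, b3, inv_one]
    · exact (congrArg (·⁻¹) (b4 g V)).trans (map_inv (glTwist R V g) (β V)).symm

lemma IsGTensorAut.extend {R S : GAlg G k} (f : R ⟶ S)
    {β : ∀ V : Rep H, (R ⊗[k] V) ≃ₗ[R] (R ⊗[k] V)} (hβ : IsGTensorAut R β) :
    IsGTensorAut S (fun V => extendAut f.toAlgHom V (β V)) := by
  obtain ⟨b1, b2, b3, b4⟩ := (isGTensorAut_iff R _).1 hβ
  refine (isGTensorAut_iff S _).2 ⟨fun {V W} t => ?_, fun V W => ?_, ?_, fun g V => ?_⟩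
  · have hb : GTannaka.extend f.toAlgHom (t.toLinearMap.baseChange R) =
        t.toLinearMap.baseChange S :=
      extend_unique _ _ _ fun v => by simp
    rw [extendAut_toLinearMap, extendAut_toLinearMap, ← hb, ← extend_comp, ← extend_comp, b1]
  · rw [b2]; exact glTensor_natural f V W (β V) (β W)
  · rw [b3]; exact map_one _
  · rw [b4]; exact glTwist_natural f V g (β V)

/-- The group functor `Aut^{G,⊗}(ω)` on `k`-`G`-algebras, where `ω` is the forgetful
`G`-`⊗`-functor on `Rep(H)`.  A morphism `R → S` sends an automorphism to its base change. -/
def autFunctor (H : GAlg.{u, v} G k ⥤ GrpCat.{u}) :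
    GAlg.{u, v} G k ⥤ GrpCat.{max (u + 1) v} where
  obj R := GrpCat.of (gTensorAut H R)
  map {R S} f := GrpCat.ofHom
    { toFun := fun β => ⟨fun V => extendAut f.toAlgHom V (β.1 V), IsGTensorAut.extend f β.2⟩
      map_one' := by ext1; funext V; exact map_one _
      map_mul' := fun β γ => by ext1; funext V; exact map_mul _ _ _ }
  map_id R := by
    ext β : 2
    apply Subtype.ext
    funext V
    exact LinearEquiv.toLinearMap_injective (extend_algHom_id _)
  map_comp f f' := by
    ext β : 2
    apply Subtype.ext
    funext V
    exact LinearEquiv.toLinearMap_injective (extend_algHom_comp _ _ _)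

lemma isGTensorAut_act (R : GAlg G k) (h : H.obj R) :
    IsGTensorAut R (fun V : Rep H => V.act R h) :=
  (isGTensorAut_iff R _).2
    ⟨fun f => f.equivariant R h, fun _ _ => rfl, rfl, fun _ _ => rfl⟩

/-- The canonical morphism `H → Aut^{G,⊗}(ω)` of group functors on `k`-`G`-algebras: an element
`h ∈ H(R)` is sent to the family of its actions on the `R ⊗ V`.  (`GrpCat.uliftFunctor` only
moves the groups `H(R)` to the universe of the groups `Aut^{G,⊗}(ω)(R)`.) -/
def canonical (H : GAlg.{u, v} G k ⥤ GrpCat.{u}) :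
    H ⋙ GrpCat.uliftFunctor.{max (u + 1) v, u} ⟶ autFunctor H where
  app R := GrpCat.ofHom
    { toFun := fun h => ⟨fun V => V.act R h.down, isGTensorAut_act R h.down⟩
      map_one' := by ext1; funext V; exact map_one (V.act R)
      map_mul' := fun h h' => by ext1; funext V; exact map_mul (V.act R) h.down h'.down }
  naturality R S f := by
    ext h : 2
    apply Subtype.ext
    funext V
    exact V.act_map f h.down

end

end GTannaka

end

noncomputable section

namespace GTannaka

variable {G : Type v} [Monoid G] {k : Type u} [Field k] [MulSemiringAction G k]

/-! Let `A` corepresent `H`. By Yoneda, the universal point `generic e` of `H(A)` turns the group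
law into a comultiplication and a counit on `A`, and `h ∈ H(R)` acts on a representation `U` by
pushing the coaction `U → A ⊗ U` forward along the map `A ⟶ R` that classifies `h`. So `h` is known
once the classifying map is known on the matrix coefficients `U.coeff e l w` in `A`.

Matrix coefficients exhaust `A`: every element lies in a finite-dimensional subcomodule `V`
(`exists_isSubcomodule_mem`), and `a ∈ V` is the coefficient of `V` at the vector `a` and the
functional counit restricted to `V` (`IsSubcomodule.coeff_rep`). This gives injectivity.

For surjectivity, a tensor automorphism `β` over `R` should come from the map `F : A ⟶ R` taking the
coefficient of `(U, l, w)` to the corresponding coefficient `matCoeff β U l w`. It is well defined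
because `U.coeff e l` is itself a morphism from `U` to a subcomodule, so naturality of `β` makes
`matCoeff` depend on the element of `A` alone (`IsGTensorAut.matCoeff_congr`). Compatibility with
tensor products, the unit and twists makes `F` multiplicative, unital and `G`-equivariant
(`IsGTensorAut.exists_hom`). The subcomodules need not be `G`-stable: the `G`-structure enters only
through the representations `U.twist g`. -/

/-! ## Coproducts of `k`-`G`-algebras -/

/-- The diagonal action of `g` on `R ⊗ S`, as an additive map. -/
def GAlg.tensorSMulAdd (R S : GAlg G k) (g : G) : R ⊗[k] S →+ R ⊗[k] S :=
  TensorProduct.liftAddHom (R := k)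
    { toFun := fun r =>
        { toFun := fun s => (g • r) ⊗ₜ[k] (g • s)
          map_zero' := by simp
          map_add' := fun s s' => by rw [smul_add, TensorProduct.tmul_add] }
      map_zero' := by ext s; simp
      map_add' := fun r r' => by ext s; simp [TensorProduct.add_tmul] }
    (fun a r s => by
      simp only [AddMonoidHom.coe_mk, ZeroHom.coe_mk, Algebra.smul_def, smul_mul',
        GAlg.smul_algebraMap]
      rw [← Algebra.smul_def, ← Algebra.smul_def, TensorProduct.smul_tmul])

@[simp] lemma GAlg.tensorSMulAdd_tmul (R S : GAlg G k) (g : G) (r : R) (s : S) :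
    R.tensorSMulAdd S g (r ⊗ₜ s) = (g • r) ⊗ₜ (g • s) := rfl

/-- Each `g` acts only semilinearly over `k`, so the diagonal action is built from additive maps and
its axioms are checked on pure tensors. -/
instance GAlg.tensorAction (R S : GAlg G k) : MulSemiringAction G (R ⊗[k] S) where
  smul g x := R.tensorSMulAdd S g x
  one_smul x := by
    change R.tensorSMulAdd S 1 x = x
    induction x with
    | zero => simp
    | add x y hx hy => rw [map_add, hx, hy]
    | tmul r s => simp
  mul_smul g g' x := by
    change R.tensorSMulAdd S (g * g') x = R.tensorSMulAdd S g (R.tensorSMulAdd S g' x)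
    induction x with
    | zero => simp
    | add x y hx hy => simp only [map_add, hx, hy]
    | tmul r s => simp [mul_smul]
  smul_zero g := map_zero (R.tensorSMulAdd S g)
  smul_add g := map_add (R.tensorSMulAdd S g)
  smul_one g := by
    change R.tensorSMulAdd S g (1 ⊗ₜ 1) = 1 ⊗ₜ 1
    simp
  smul_mul g x y := by
    change R.tensorSMulAdd S g (x * y) = R.tensorSMulAdd S g x * R.tensorSMulAdd S g y
    induction x with
    | zero => simp
    | add x x' hx hx' => simp only [add_mul, map_add, hx, hx']
    | tmul r s =>
      induction y with
      | zero => simp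
      | add y y' hy hy' => simp only [mul_add, map_add, hy, hy']
      | tmul r' s' => simp

lemma GAlg.smul_tmul' (R S : GAlg G k) (g : G) (r : R) (s : S) :
    g • (r ⊗ₜ[k] s) = (g • r) ⊗ₜ[k] (g • s) := rfl

/-- The coproduct of `k`-`G`-algebras: `R ⊗ S` with the diagonal action. -/
abbrev GAlg.tensor (R S : GAlg G k) : GAlg G k where
  carrier := R ⊗[k] S
  smul_algebraMap g a := by
    rw [Algebra.TensorProduct.algebraMap_apply, Algebra.TensorProduct.algebraMap_apply,
      GAlg.smul_tmul', smul_one, GAlg.smul_algebraMap]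

/-- The inclusion `R → R ⊗ S`. -/
def GAlg.inl (R S : GAlg G k) : R ⟶ R.tensor S :=
  GAlg.Hom.mk (Algebra.TensorProduct.includeLeft : R →ₐ[k] R ⊗[k] S) fun g r => by
    change (g • r) ⊗ₜ[k] (1 : S) = g • (r ⊗ₜ[k] (1 : S))
    rw [GAlg.smul_tmul', smul_one]

/-- The inclusion `S → R ⊗ S`. -/
def GAlg.inr (R S : GAlg G k) : S ⟶ R.tensor S :=
  GAlg.Hom.mk (Algebra.TensorProduct.includeRight : S →ₐ[k] R ⊗[k] S) fun g s => by
    change (1 : R) ⊗ₜ[k] (g • s) = g • ((1 : R) ⊗ₜ[k] s)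
    rw [GAlg.smul_tmul', smul_one]

lemma GAlg.inl_apply (R S : GAlg G k) (r : R) :
    (R.inl S).toAlgHom r = r ⊗ₜ[k] (1 : S) := rfl

lemma GAlg.inr_apply (R S : GAlg G k) (s : S) :
    (R.inr S).toAlgHom s = (1 : R) ⊗ₜ[k] s := rfl

/-- The morphism `R ⊗ S → T` induced by `R → T` and `S → T`. -/
def GAlg.desc {R S T : GAlg G k} (p : R ⟶ T) (q : S ⟶ T) : R.tensor S ⟶ T :=
  GAlg.Hom.mk (Algebra.TensorProduct.lift p.toAlgHom q.toAlgHom fun _ _ => Commute.all _ _)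
    fun g x => by
      induction x using TensorProduct.induction_on with
      | zero => simp
      | add x y hx hy => simp only [smul_add, map_add, hx, hy]
      | tmul r s => rw [GAlg.smul_tmul']; simp [GAlg.Hom.map_smul]

@[simp] lemma GAlg.desc_tmul {R S T : GAlg G k} (p : R ⟶ T) (q : S ⟶ T) (r : R) (s : S) :
    (GAlg.desc p q).toAlgHom (r ⊗ₜ[k] s) = p.toAlgHom r * q.toAlgHom s := rfl

lemma GAlg.hom_ext {R S : GAlg G k} {p q : R ⟶ S} (h : ∀ r, p.toAlgHom r = q.toAlgHom r) :
    p = q :=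
  GAlg.Hom.ext (AlgHom.ext h)

@[simp] lemma GAlg.inl_desc {R S T : GAlg G k} (p : R ⟶ T) (q : S ⟶ T) :
    R.inl S ≫ GAlg.desc p q = p :=
  GAlg.hom_ext fun r => by
    rw [GAlg.comp_toAlgHom, AlgHom.comp_apply, GAlg.inl_apply, GAlg.desc_tmul, map_one, mul_one]

@[simp] lemma GAlg.inl_desc_assoc {R S T U : GAlg G k} (p : R ⟶ T) (q : S ⟶ T) (f : T ⟶ U) :
    R.inl S ≫ GAlg.desc p q ≫ f = p ≫ f := by
  rw [← Category.assoc, GAlg.inl_desc]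

@[simp] lemma GAlg.inr_desc {R S T : GAlg G k} (p : R ⟶ T) (q : S ⟶ T) :
    R.inr S ≫ GAlg.desc p q = q :=
  GAlg.hom_ext fun r => by
    rw [GAlg.comp_toAlgHom, AlgHom.comp_apply, GAlg.inr_apply, GAlg.desc_tmul, map_one, one_mul]

@[simp] lemma GAlg.inr_desc_assoc {R S T U : GAlg G k} (p : R ⟶ T) (q : S ⟶ T) (f : T ⟶ U) :
    R.inr S ≫ GAlg.desc p q ≫ f = q ≫ f := by
  rw [← Category.assoc, GAlg.inr_desc]

lemma GAlg.desc_ext {R S T : GAlg G k} {p q : R.tensor S ⟶ T}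
    (hl : R.inl S ≫ p = R.inl S ≫ q) (hr : R.inr S ≫ p = R.inr S ≫ q) : p = q :=
  GAlg.Hom.ext (Algebra.TensorProduct.ext (congrArg GAlg.Hom.toAlgHom hl)
    (congrArg GAlg.Hom.toAlgHom hr))

/-- The initial `k`-`G`-algebra `k`. -/
abbrev GAlg.base (G : Type v) [Monoid G] (k : Type u) [Field k] [MulSemiringAction G k] :
    GAlg G k where
  carrier := k
  smul_algebraMap _ _ := rfl

/-- The structure map `k → R`. -/
def GAlg.fromBase (R : GAlg G k) : GAlg.base G k ⟶ R :=
  GAlg.Hom.mk (Algebra.ofId k R) fun g a => (R.smul_algebraMap g a).symm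

/-! ## The coalgebra structure on a corepresenting algebra -/

variable {H : GAlg.{u, v} G k ⥤ GrpCat.{u}} {A : GAlg G k}

/-- The universal element of `H(A)`. -/
def generic (e : (H ⋙ forget GrpCat.{u}).CorepresentableBy A) : H.obj A := e.homEquiv (𝟙 A)

/-- The morphism `A → R` corresponding to an element of `H(R)`. -/
def classify (e : (H ⋙ forget GrpCat.{u}).CorepresentableBy A) {R : GAlg G k} (h : H.obj R) :
    A ⟶ R := e.homEquiv.symm h

variable (e : (H ⋙ forget GrpCat.{u}).CorepresentableBy A)

lemma map_generic {R : GAlg G k} (f : A ⟶ R) : H.map f (generic e) = e.homEquiv f :=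
  (e.homEquiv_eq f).symm

@[simp] lemma map_classify {R : GAlg G k} (h : H.obj R) :
    H.map (classify e h) (generic e) = h := by
  rw [map_generic]
  exact e.homEquiv.apply_symm_apply h

lemma generic_ext {R : GAlg G k} {f f' : A ⟶ R}
    (h : H.map f (generic e) = H.map f' (generic e)) : f = f' := by
  rw [map_generic, map_generic] at h
  exact e.homEquiv.injective h

lemma map_comp_apply' {R S T : GAlg G k} (f : R ⟶ S) (f' : S ⟶ T) (h : H.obj R) :
    H.map (f ≫ f') h = H.map f' (H.map f h) := by
  simp

lemma classify_comp {R S : GAlg G k} (h : H.obj R) (f : R ⟶ S) :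
    classify e h ≫ f = classify e (H.map f h) :=
  generic_ext e (by rw [map_comp_apply', map_classify, map_classify])

/-- The algebra map `R ⊗ A → R ⊗ A` by which `h ∈ H(R)` acts in the regular representation. -/
def regular {R : GAlg G k} (h : H.obj R) : R.tensor A ⟶ R.tensor A :=
  GAlg.desc (R.inl A) (classify e (H.map (R.inr A) (generic e) * H.map (R.inl A) h))

lemma regular_one (R : GAlg G k) : regular e (1 : H.obj R) = 𝟙 _ := by
  refine GAlg.desc_ext (by simp [regular]) ?_
  rw [regular, GAlg.inr_desc]
  exact generic_ext e (by simp)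

/-- With elements of `A` read as functions on `H`, the regular action is right translation, `(h ·
f)(x) = f(x h)`. It is therefore a left action; the order looks reversed because `≫` applies its
left argument first. -/
lemma regular_mul {R : GAlg G k} (h h' : H.obj R) :
    regular e (h * h') = regular e h' ≫ regular e h := by
  refine GAlg.desc_ext (by simp [regular]) ?_
  -- Morphisms out of `A` are compared as points of `H`, where the claim is associativity of the
  -- group law.
  refine generic_ext e ?_
  simp only [regular, GAlg.inr_desc, GAlg.inr_desc_assoc, classify_comp, map_classify, map_mul,
    ← map_comp_apply', GAlg.inl_desc, mul_assoc]

/-- The comultiplication `A → A ⊗ A`, for which representations of `H` are left comodules. -/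
def comul : A ⟶ A.tensor A :=
  classify e (H.map (A.inr A) (generic e) * H.map (A.inl A) (generic e))

/-- A map out of `A ⊗ A` is a pair of points, and precomposing with the comultiplication multiplies
them, the second on the left. The coalgebra axioms thereby reduce to group axioms. -/
lemma comul_desc {R : GAlg G k} (p q : A ⟶ R) :
    comul e ≫ GAlg.desc p q = classify e (H.map q (generic e) * H.map p (generic e)) := by
  rw [comul, classify_comp, map_mul, ← map_comp_apply', ← map_comp_apply', GAlg.inl_desc,
    GAlg.inr_desc]

/-- The counit `A → k`. -/
def counit : A ⟶ GAlg.base G k := classify e 1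

lemma comul_counit_right {R : GAlg G k} (p : A ⟶ R) :
    comul e ≫ GAlg.desc p (counit e ≫ R.fromBase) = p := by
  rw [comul_desc]
  exact generic_ext e (by simp [counit])

lemma comul_counit_left {R : GAlg G k} (p : A ⟶ R) :
    comul e ≫ GAlg.desc (counit e ≫ R.fromBase) p = p := by
  rw [comul_desc]
  exact generic_ext e (by simp [counit])

lemma comul_coassoc :
    comul e ≫ GAlg.desc (comul e ≫ GAlg.desc (A.inl (A.tensor A)) (A.inl A ≫ A.inr (A.tensor A)))
        (A.inr A ≫ A.inr (A.tensor A)) =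
      comul e ≫ GAlg.desc (A.inl (A.tensor A)) (comul e ≫ A.inr (A.tensor A)) := by
  -- Writing this inclusion as a `desc` lets `comul_desc` evaluate the inner comultiplication on the
  -- right-hand side too; both sides then classify a product of three universal points.
  have h : A.inr (A.tensor A) =
      GAlg.desc (A.inl A ≫ A.inr (A.tensor A)) (A.inr A ≫ A.inr (A.tensor A)) :=
    GAlg.desc_ext (by simp) (by simp)
  conv_rhs => rw [h]
  simp only [comul_desc, map_classify, mul_assoc]

/-- The comultiplication as a linear map. -/
def comulLin : A →ₗ[k] A ⊗[k] A := (comul e).toAlgHom.toLinearMap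

lemma comulLin_apply (a : A) : comulLin e a = (comul e).toAlgHom a := rfl

/-- The counit as a linear functional. -/
def counitLin : A →ₗ[k] k := (counit e).toAlgHom.toLinearMap

lemma counitLin_apply (a : A) : counitLin e a = (counit e).toAlgHom a := rfl

lemma comulLin_coassoc (a : A) :
    TensorProduct.assoc k A A A ((comulLin e).rTensor A (comulLin e a)) =
      (comulLin e).lTensor A (comulLin e a) := by
  have h := DFunLike.congr_fun (congrArg GAlg.Hom.toAlgHom (comul_coassoc e)) a
  -- `hl` and `hr` identify the algebra maps in `comul_coassoc` with linear maps on tensor products,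
  -- by evaluation on pure tensors.
  have hl : ∀ x : A ⊗[k] A,
      (GAlg.desc (comul e ≫ GAlg.desc (A.inl (A.tensor A)) (A.inl A ≫ A.inr (A.tensor A)))
        (A.inr A ≫ A.inr (A.tensor A))).toAlgHom x =
      TensorProduct.assoc k A A A ((comulLin e).rTensor A x) := fun x => by
    induction x with
    | zero => simp
    | add x y hx hy => simp only [map_add, hx, hy]
    | tmul b c =>
      rw [GAlg.desc_tmul, LinearMap.rTensor_tmul, comulLin_apply, GAlg.comp_toAlgHom,
        AlgHom.comp_apply]
      generalize (comul e).toAlgHom b = y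
      induction y using TensorProduct.induction_on with
      | zero => simp
      | add x y hx hy => simp only [map_add, TensorProduct.add_tmul, add_mul, hx, hy]
      | tmul b b' =>
        rw [GAlg.desc_tmul, GAlg.comp_toAlgHom, AlgHom.comp_apply, GAlg.comp_toAlgHom,
          AlgHom.comp_apply, GAlg.inl_apply, GAlg.inl_apply, GAlg.inr_apply, GAlg.inr_apply,
          GAlg.inr_apply, TensorProduct.assoc_tmul]
        simp only [Algebra.TensorProduct.tmul_mul_tmul, one_mul, mul_one]
  have hr : ∀ x : A ⊗[k] A,
      (GAlg.desc (A.inl (A.tensor A)) (comul e ≫ A.inr (A.tensor A))).toAlgHom x =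
      (comulLin e).lTensor A x := fun x => by
    induction x with
    | zero => simp
    | add x y hx hy => simp only [map_add, hx, hy]
    | tmul b c =>
      rw [GAlg.desc_tmul, GAlg.comp_toAlgHom, AlgHom.comp_apply, GAlg.inl_apply, GAlg.inr_apply,
        LinearMap.lTensor_tmul, comulLin_apply, Algebra.TensorProduct.tmul_mul_tmul, mul_one,
        one_mul]
  rw [comulLin_apply, ← hl, ← hr]
  exact h

lemma lid_counit_comul (a : A) :
    TensorProduct.lid k A ((counitLin e).rTensor A (comulLin e a)) = a := by
  have h := DFunLike.congr_fun (congrArg GAlg.Hom.toAlgHom (comul_counit_left e (𝟙 A))) a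
  have hl : ∀ x : A ⊗[k] A,
      (GAlg.desc (counit e ≫ A.fromBase) (𝟙 A)).toAlgHom x =
      TensorProduct.lid k A ((counitLin e).rTensor A x) := fun x => by
    induction x with
    | zero => simp
    | add x y hx hy => simp only [map_add, hx, hy]
    | tmul b c =>
      rw [GAlg.desc_tmul, LinearMap.rTensor_tmul, TensorProduct.lid_tmul, Algebra.smul_def]
      rfl
  rw [comulLin_apply, ← hl]
  exact h

/-! ## Local finiteness of the regular representation -/

/-- A subspace `V` of `A` is a subcomodule if the comultiplication maps it into `A ⊗ V`. -/
def IsSubcomodule (V : Submodule k A) : Prop :=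
  ∀ a ∈ V, comulLin e a ∈ LinearMap.range (V.subtype.lTensor A)

lemma range_lTensor_subtype_mono {B : Type*} [AddCommGroup B] [Module k B]
    {M : Type*} [AddCommGroup M] [Module k M] {V W : Submodule k M} (h : V ≤ W) :
    LinearMap.range (V.subtype.lTensor B) ≤ LinearMap.range (W.subtype.lTensor B) := by
  rw [← Submodule.subtype_comp_inclusion V W h, LinearMap.lTensor_comp]
  exact LinearMap.range_comp_le_range _ _

lemma IsSubcomodule.sup {V W : Submodule k A} (hV : IsSubcomodule e V) (hW : IsSubcomodule e W) :
    IsSubcomodule e (V ⊔ W) := by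
  intro a ha
  obtain ⟨b, hb, c, hc, rfl⟩ := Submodule.mem_sup.1 ha
  rw [map_add]
  exact add_mem (range_lTensor_subtype_mono le_sup_left (hV b hb))
    (range_lTensor_subtype_mono le_sup_right (hW c hc))

/-- Write `Δ a = ∑ bᵢ ⊗ cᵢ` with `bᵢ` from a basis of `A`, and let `V` be the span of the finitely
many nonzero `cᵢ`. Coassociativity gives `∑ bᵢ ⊗ Δ cᵢ = ∑ Δ bᵢ ⊗ cᵢ`; extracting the coordinate at
`bⱼ` shows `Δ cⱼ ∈ A ⊗ V`. -/
lemma exists_isSubcomodule_mem (a : A) :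
    ∃ V : Submodule k A, V.FG ∧ IsSubcomodule e V ∧ a ∈ V := by
  classical
  let b := Module.Basis.ofVectorSpace k A
  obtain ⟨c, hc⟩ := TensorProduct.eq_repr_basis_left b (comulLin e a)
  let V : Submodule k A := Submodule.span k (c.support.image c : Finset A)
  have hcV : ∀ i, c i ∈ V := fun i => by
    by_cases hi : c i = 0
    · rw [hi]; exact zero_mem _
    · exact Submodule.subset_span
        (Finset.mem_coe.2 (Finset.mem_image_of_mem c (Finsupp.mem_support_iff.2 hi)))
  refine ⟨V, ⟨_, rfl⟩, ?_, ?_⟩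
  · suffices V ≤ (LinearMap.range (V.subtype.lTensor A)).comap (comulLin e) from
      fun a ha => this ha
    refine Submodule.span_le.2 fun x hx => ?_
    obtain ⟨j, -, rfl⟩ := Finset.mem_image.1 (Finset.mem_coe.1 hx)
    -- Contraction of the first factor with the `j`-th coordinate functional. It is used both for `M
    -- = A` and for `M = A ⊗ A`.
    let t (M : Type u) [AddCommGroup M] [Module k M] : A ⊗[k] M →ₗ[k] M :=
      (TensorProduct.lid k M).toLinearMap ∘ₗ (b.coord j).rTensor M
    have htn : ∀ z : A ⊗[k] A, t _ ((comulLin e).lTensor A z) = comulLin e (t _ z) := fun z => by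
      induction z with
      | zero => simp
      | add x y hx hy => simp only [map_add, hx, hy]
      | tmul x y => simp [t]
    have hta : ∀ (z : A ⊗[k] A) (y : A), y ∈ V →
        t _ (TensorProduct.assoc k A A A (z ⊗ₜ y)) ∈ LinearMap.range (V.subtype.lTensor A) := by
      intro z y hy
      induction z with
      | zero => simp
      | add x y hx hy => simp only [map_add, TensorProduct.add_tmul]; exact add_mem hx hy
      | tmul p q =>
        refine ⟨(b.coord j p • q) ⊗ₜ ⟨y, hy⟩, ?_⟩
        simp [t, TensorProduct.smul_tmul']
    have hcj : c j = t _ (comulLin e a) := by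
      rw [← hc, Finsupp.sum, map_sum, Finset.sum_eq_single j]
      · simp [t]
      · intro i _ hij
        simp [t, Finsupp.single_eq_of_ne hij.symm]
      · intro hj
        simp [Finsupp.notMem_support_iff.1 hj]
    change comulLin e (c j) ∈ LinearMap.range (V.subtype.lTensor A)
    rw [hcj, ← htn, ← comulLin_coassoc]
    rw [← hc]
    simp only [Finsupp.sum, map_sum, LinearMap.rTensor_tmul]
    exact sum_mem fun i _ => hta _ _ (hcV i)
  -- The counit axiom reads `a = ∑ ε(bᵢ) cᵢ`, a combination of the generators of `V`.
  · rw [← lid_counit_comul e a, ← hc]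
    simp only [Finsupp.sum, map_sum, LinearMap.rTensor_tmul, TensorProduct.lid_tmul]
    exact sum_mem fun i _ => V.smul_mem _ (hcV i)

lemma exists_isSubcomodule_le (N : Submodule k A) (hN : N.FG) :
    ∃ V : Submodule k A, V.FG ∧ IsSubcomodule e V ∧ N ≤ V := by
  refine Submodule.fg_induction
    (motive := fun N _ => ∃ V : Submodule k A, V.FG ∧ IsSubcomodule e V ∧ N ≤ V) ?_ ?_ N hN
  · intro a
    obtain ⟨V, h, h', h''⟩ := exists_isSubcomodule_mem e a
    exact ⟨V, h, h', (Submodule.span_singleton_le_iff_mem a V).2 h''⟩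
  · rintro N N' _ _ ⟨V, h1, h2, h3⟩ ⟨V', h1', h2', h3'⟩
    exact ⟨V ⊔ V', h1.sup h1', h2.sup e h2', sup_le_sup h3 h3'⟩

/-! ## The representation on a finite-dimensional subcomodule -/

lemma push_baseChange {R S : Type u} [CommRing R] [Algebra k R] [CommRing S] [Algebra k S]
    (φ : R →ₐ[k] S) {V W : Type u} [AddCommGroup V] [Module k V] [AddCommGroup W] [Module k W]
    (f : V →ₗ[k] W) (z : R ⊗[k] V) :
    push φ W (f.baseChange R z) = f.baseChange S (push φ V z) := by
  induction z with
  | zero => simp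
  | add x y hx hy => simp only [map_add, hx, hy]
  | tmul r v => simp

lemma regular_inl {R : GAlg G k} (h : H.obj R) (r : R) :
    (regular e h).toAlgHom (r ⊗ₜ[k] (1 : A)) = r ⊗ₜ[k] (1 : A) := by
  rw [← GAlg.inl_apply, ← AlgHom.comp_apply, ← GAlg.comp_toAlgHom, regular, GAlg.inl_desc]

/-- The action of `h ∈ H(R)` on `R ⊗ A` as an `R`-linear map. -/
def regularLin {R : GAlg G k} (h : H.obj R) : R ⊗[k] A →ₗ[R] R ⊗[k] A :=
  { (regular e h).toAlgHom.toLinearMap with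
    map_smul' := fun r x => by
      have hr (x : R ⊗[k] A) : r • x = (r ⊗ₜ[k] (1 : A)) * x := Algebra.smul_def r x
      change (regular e h).toAlgHom (r • x) = r • (regular e h).toAlgHom x
      rw [hr, hr, map_mul, regular_inl] }

lemma regularLin_apply {R : GAlg G k} (h : H.obj R) (x : R ⊗[k] A) :
    regularLin e h x = (regular e h).toAlgHom x := rfl

/-- Both sides, as maps `A ⟶ R ⊗ A`, classify the product of the universal point and `h`. This ties
right translation to the comultiplication, so that subcomodules are stable under the regular action.
-/
lemma regularLin_one_tmul {R : GAlg G k} (h : H.obj R) (a : A) :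
    regularLin e h (1 ⊗ₜ a) = push (classify e h).toAlgHom A (comulLin e a) := by
  have h1 : R.inr A ≫ regular e h = comul e ≫ GAlg.desc (classify e h ≫ R.inl A) (R.inr A) := by
    rw [comul_desc, regular, GAlg.inr_desc, map_comp_apply', map_classify]
  have h2 : ∀ x : A ⊗[k] A, (GAlg.desc (classify e h ≫ R.inl A) (R.inr A)).toAlgHom x =
      push (classify e h).toAlgHom A x := fun x => by
    induction x with
    | zero => simp
    | add x y hx hy => simp only [map_add, hx, hy]
    | tmul b c =>
      rw [GAlg.desc_tmul, GAlg.comp_toAlgHom, AlgHom.comp_apply, GAlg.inl_apply, GAlg.inr_apply,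
        push_tmul, Algebra.TensorProduct.tmul_mul_tmul, mul_one, one_mul]
  rw [← h2]
  exact DFunLike.congr_fun (congrArg GAlg.Hom.toAlgHom h1) a

lemma regularLin_one (R : GAlg G k) (x : R ⊗[k] A) : regularLin e (1 : H.obj R) x = x := by
  rw [regularLin_apply, regular_one]
  rfl

lemma regularLin_mul {R : GAlg G k} (h h' : H.obj R) (x : R ⊗[k] A) :
    regularLin e (h * h') x = regularLin e h (regularLin e h' x) := by
  rw [regularLin_apply, regular_mul]
  rfl

lemma push_regularLin {R S : GAlg G k} (f : R ⟶ S) (h : H.obj R) (a : A) :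
    push f.toAlgHom A (regularLin e h (1 ⊗ₜ a)) = regularLin e (H.map f h) (1 ⊗ₜ a) := by
  rw [regularLin_one_tmul, regularLin_one_tmul, ← classify_comp]
  generalize comulLin e a = z
  induction z with
  | zero => simp
  | add x y hx hy => simp only [map_add, hx, hy]
  | tmul r v => simp

/-- Flatness of `R` over the field `k`. Identities for the action on `R ⊗ V` can then be verified
inside `R ⊗ A`. -/
lemma baseChange_subtype_injective (R : GAlg G k) (V : Submodule k A) :
    Function.Injective (V.subtype.baseChange R) :=
  Module.Flat.lTensor_preserves_injective_linearMap V.subtype V.injective_subtype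

variable {e}

lemma IsSubcomodule.regularLin_mem {V : Submodule k A} (hV : IsSubcomodule e V) {R : GAlg G k}
    (h : H.obj R) (y : R ⊗[k] V) :
    regularLin e h (V.subtype.baseChange R y) ∈ LinearMap.range (V.subtype.baseChange R) := by
  induction y with
  | zero => simp
  | add x y hx hy => simp only [map_add]; exact add_mem hx hy
  | tmul r v =>
    obtain ⟨z, hz⟩ := hV v v.2
    have hr : V.subtype.baseChange R (r ⊗ₜ v) = r • ((1 : R) ⊗ₜ[k] (v : A)) := by
      simp [TensorProduct.smul_tmul']
    rw [hr, map_smul, regularLin_one_tmul, ← hz]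
    -- The preimage is the lift `z ∈ A ⊗ V` of `Δ v`, specialised at the point `h`.
    refine Submodule.smul_mem _ _ ⟨push (classify e h).toAlgHom V z, ?_⟩
    rw [← push_baseChange]
    rfl

/-- The restriction of the regular action to a subcomodule. -/
def IsSubcomodule.actLin {V : Submodule k A} (hV : IsSubcomodule e V) {R : GAlg G k}
    (h : H.obj R) : R ⊗[k] V →ₗ[R] R ⊗[k] V :=
  (LinearEquiv.ofInjective _ (baseChange_subtype_injective R V)).symm.toLinearMap ∘ₗ
    (regularLin e h ∘ₗ V.subtype.baseChange R).codRestrict _ (hV.regularLin_mem h)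

lemma IsSubcomodule.incl_actLin {V : Submodule k A} (hV : IsSubcomodule e V) {R : GAlg G k}
    (h : H.obj R) (y : R ⊗[k] V) :
    V.subtype.baseChange R (hV.actLin h y) = regularLin e h (V.subtype.baseChange R y) :=
  congrArg Subtype.val ((LinearEquiv.ofInjective _
    (baseChange_subtype_injective R V)).apply_symm_apply
      ((regularLin e h ∘ₗ V.subtype.baseChange R).codRestrict _ (hV.regularLin_mem h) y))

lemma IsSubcomodule.actLin_mul {V : Submodule k A} (hV : IsSubcomodule e V) {R : GAlg G k}
    (h h' : H.obj R) : hV.actLin (h * h') = hV.actLin h ∘ₗ hV.actLin h' :=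
  LinearMap.ext fun y => baseChange_subtype_injective R V (by
    rw [incl_actLin, regularLin_mul, LinearMap.comp_apply, incl_actLin, incl_actLin])

lemma IsSubcomodule.actLin_one {V : Submodule k A} (hV : IsSubcomodule e V) (R : GAlg G k) :
    hV.actLin (1 : H.obj R) = LinearMap.id :=
  LinearMap.ext fun y => baseChange_subtype_injective R V (by
    rw [incl_actLin, regularLin_one, LinearMap.id_apply])

/-- The representation of `H` on a finite-dimensional subcomodule of `A`. -/
def IsSubcomodule.rep {V : Submodule k A} (hV : IsSubcomodule e V) (hfg : V.FG) : Rep H where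
  carrier := V
  finite := Module.Finite.iff_fg.2 hfg
  φ :=
    { app := fun R => GrpCat.ofHom
        { toFun := fun h => LinearEquiv.ofLinearMap (hV.actLin h) (hV.actLin h⁻¹)
            (by rw [← hV.actLin_mul, mul_inv_cancel, hV.actLin_one])
            (by rw [← hV.actLin_mul, inv_mul_cancel, hV.actLin_one])
          map_one' := LinearEquiv.toLinearMap_injective (hV.actLin_one R)
          map_mul' := fun h h' => LinearEquiv.toLinearMap_injective (hV.actLin_mul h h') }
      naturality := fun R S f => by
        ext h : 2
        refine LinearEquiv.toLinearMap_injective (extend_unique f.toAlgHom (hV.actLin h)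
          (hV.actLin (H.map f h)) fun v => baseChange_subtype_injective S V ?_).symm
        rw [← push_baseChange, hV.incl_actLin, hV.incl_actLin]
        exact (push_regularLin e f h v).symm }

lemma IsSubcomodule.incl_rep_act {V : Submodule k A} (hV : IsSubcomodule e V) (hfg : V.FG)
    {R : GAlg G k} (h : H.obj R) (v : V) :
    V.subtype.baseChange R ((hV.rep hfg).act R h ((1 : R) ⊗ₜ[k] v)) =
      push (classify e h).toAlgHom A (comulLin e v) :=
  (hV.incl_actLin h _).trans (regularLin_one_tmul e h v)

/-! ## Matrix coefficients -/

/-- The `R`-linear extension `R ⊗ U → R` of a functional on `U`. -/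
def pair (R : Type u) [CommRing R] [Algebra k R] {U : Type u} [AddCommGroup U] [Module k U]
    (l : U →ₗ[k] k) : R ⊗[k] U →ₗ[R] R :=
  (TensorProduct.AlgebraTensorModule.rid k R R).toLinearMap ∘ₗ l.baseChange R

section pair

variable {R S : Type u} [CommRing R] [Algebra k R] [CommRing S] [Algebra k S]
variable {U W : Type u} [AddCommGroup U] [Module k U] [AddCommGroup W] [Module k W]

@[simp] lemma pair_tmul (l : U →ₗ[k] k) (r : R) (u : U) : pair R l (r ⊗ₜ u) = l u • r := rfl

lemma pair_push (φ : R →ₐ[k] S) (l : U →ₗ[k] k) (z : R ⊗[k] U) :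
    pair S l (push φ U z) = φ (pair R l z) := by
  induction z with
  | zero => simp
  | add x y hx hy => simp only [map_add, hx, hy]
  | tmul r v => simp

lemma pair_baseChange (l : W →ₗ[k] k) (f : U →ₗ[k] W) (z : R ⊗[k] U) :
    pair R l (f.baseChange R z) = pair R (l ∘ₗ f) z := by
  rw [pair, pair, LinearMap.baseChange_comp]
  rfl

/-- The functionals include the coordinates of a `k`-basis of `U`, which is also an `R`-basis of `R
⊗ U`. Thus an `R`-linear map is determined by its matrix coefficients. -/
lemma pair_ext {z z' : R ⊗[k] U} (h : ∀ l : U →ₗ[k] k, pair R l z = pair R l z') : z = z' := by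
  let b := Module.Basis.ofVectorSpace k U
  refine (b.baseChange R).ext_elem fun i => ?_
  have hi : ∀ z : R ⊗[k] U, (b.baseChange R).repr z i = pair R (b.coord i) z := fun z => by
    induction z with
    | zero => simp
    | add x y hx hy => simp only [map_add, Finsupp.add_apply, hx, hy]
    | tmul r v => simp
  rw [hi, hi, h]

end pair

variable (e)

/-- The coaction `U → A ⊗ U` of a representation. -/
def Rep.coact (U : Rep H) : U →ₗ[k] A ⊗[k] U :=
  ((U.act A (generic e)).toLinearMap.restrictScalars k) ∘ₗ TensorProduct.mk k A U 1

/-- Every point is the image of the universal one under its classifying map, and the action is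
natural. -/
lemma Rep.act_one_tmul (U : Rep H) {R : GAlg G k} (h : H.obj R) (w : U) :
    U.act R h ((1 : R) ⊗ₜ[k] w) = push (classify e h).toAlgHom U (U.coact e w) := by
  conv_lhs => rw [← map_classify e h, U.act_map]
  exact extend_one_tmul _ _ _

/-- The matrix coefficient `U → A` of a representation attached to a functional. -/
def Rep.coeff (U : Rep H) (l : U →ₗ[k] k) : U →ₗ[k] A :=
  (pair A l).restrictScalars k ∘ₗ U.coact e

lemma Rep.coeff_eq (U : Rep H) (l : U →ₗ[k] k) (w : U) :
    U.coeff e l w = pair A l (U.coact e w) := rfl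

lemma Rep.pair_act (U : Rep H) (l : U →ₗ[k] k) {R : GAlg G k} (h : H.obj R) (w : U) :
    pair R l (U.act R h ((1 : R) ⊗ₜ[k] w)) = (classify e h).toAlgHom (U.coeff e l w) := by
  rw [U.act_one_tmul e, pair_push, coeff_eq]

/-- The counit evaluates a function at the identity of `H(k)`, which acts trivially. -/
lemma Rep.counit_coeff (U : Rep H) (l : U →ₗ[k] k) (w : U) :
    counitLin e (U.coeff e l w) = l w := by
  have h := U.pair_act e l (1 : H.obj (GAlg.base G k)) w
  rw [map_one] at h
  rw [counitLin_apply, counit, ← h]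
  change pair k l (1 ⊗ₜ w) = _
  simp

/-- The action of a product of two universal points is the composite of their actions. The resulting
identity makes `U.coeff e l` a comodule map from `U` to `A`, which is the equivariance needed for
`IsSubcomodule.coeffHom`. -/
lemma Rep.comul_coeff (U : Rep H) (l : U →ₗ[k] k) (w : U) :
    comulLin e (U.coeff e l w) = (U.coeff e l).lTensor A (U.coact e w) := by
  -- The left factor of the product acts linearly over `A ⊗ A`, so the coefficient in `A` already
  -- produced by the other factor is carried along as a scalar.
  have h1 : ∀ z : A ⊗[k] U, pair (A ⊗[k] A) l
      (U.act (A.tensor A) (H.map (A.inr A) (generic e)) (push (A.inl A).toAlgHom U z)) =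
      (U.coeff e l).lTensor A z := fun z => by
    induction z with
    | zero => simp
    | add x y hx hy => simp only [map_add, hx, hy]
    | tmul a u =>
      have ha : push (A.inl A).toAlgHom U (a ⊗ₜ u) =
          (a ⊗ₜ[k] (1 : A)) • ((1 : A.tensor A) ⊗ₜ[k] u) := by
        rw [push_tmul, GAlg.inl_apply, TensorProduct.smul_tmul', smul_eq_mul, mul_one]
      have hu := U.pair_act e l (H.map (A.inr A) (generic e)) u
      have hc : classify e (H.map (A.inr A) (generic e)) = A.inr A :=
        generic_ext e (map_classify e _)
      rw [hc, GAlg.inr_apply] at hu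
      rw [ha, map_smul, map_smul]
      erw [hu]
      rw [smul_eq_mul, Algebra.TensorProduct.tmul_mul_tmul, one_mul, mul_one,
        LinearMap.lTensor_tmul]
  rw [← h1, comulLin_apply, comul]
  have h2 := U.pair_act e l (H.map (A.inr A) (generic e) * H.map (A.inl A) (generic e)) w
  rw [← h2, map_mul, LinearEquiv.mul_apply]
  congr 2
  rw [U.act_map (A.inl A)]
  exact extend_one_tmul _ _ _

/-- The morphism from a representation to a subcomodule containing the values of a matrix
coefficient. -/
def IsSubcomodule.coeffHom {V : Submodule k A} (hV : IsSubcomodule e V) (hfg : V.FG)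
    (U : Rep H) (l : U →ₗ[k] k) (h : ∀ w, U.coeff e l w ∈ V) : U ⟶ hV.rep hfg :=
  Rep.Hom.mk ((U.coeff e l).codRestrict V h) fun R x => linearMap_ext fun w => by
    refine baseChange_subtype_injective R V ?_
    refine Eq.trans ?_ (hV.incl_rep_act hfg x ⟨U.coeff e l w, h w⟩).symm
    have hc : (U.coeff e l) = V.subtype ∘ₗ (U.coeff e l).codRestrict V h := rfl
    have h1 : ∀ z : R ⊗[k] U, V.subtype.baseChange R
        (((U.coeff e l).codRestrict V h).baseChange R z) = (U.coeff e l).baseChange R z :=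
      fun z => by
        conv_rhs => rw [hc, LinearMap.baseChange_comp]
        rfl
    refine (h1 _).trans ?_
    change (U.coeff e l).baseChange R (U.act R x (1 ⊗ₜ w)) =
      push (classify e x).toAlgHom A (comulLin e (U.coeff e l w))
    rw [U.act_one_tmul e, ← push_baseChange, U.comul_coeff]
    rfl

lemma pair_counit_comul (a : A) : pair A (counitLin e) (comulLin e a) = a := by
  have h := DFunLike.congr_fun (congrArg GAlg.Hom.toAlgHom (comul_counit_right e (𝟙 A))) a
  have hr : ∀ x : A ⊗[k] A,
      (GAlg.desc (𝟙 A) (counit e ≫ A.fromBase)).toAlgHom x = pair A (counitLin e) x := fun x => by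
    induction x with
    | zero => simp
    | add x y hx hy => simp only [map_add, hx, hy]
    | tmul b c =>
      rw [GAlg.desc_tmul, pair_tmul, Algebra.smul_def, mul_comm]
      rfl
  rw [comulLin_apply, ← hr]
  exact h

/-- This is the counit axiom `(id ⊗ ε) Δ a = a`: evaluating the translates of a function at the
identity recovers the function. -/
lemma IsSubcomodule.coeff_rep {V : Submodule k A} (hV : IsSubcomodule e V) (hfg : V.FG) (a : V) :
    (hV.rep hfg).coeff e (counitLin e ∘ₗ V.subtype) a = a := by
  have h1 := pair_baseChange (counitLin e) V.subtype
    ((hV.rep hfg).act A (generic e) ((1 : A) ⊗ₜ[k] a))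
  refine h1.symm.trans ?_
  have hc : classify e (generic e) = 𝟙 A := generic_ext e (by simp)
  have hp : push (AlgHom.id k A) A = LinearMap.id := by ext; simp
  rw [hV.incl_rep_act, hc, GAlg.id_toAlgHom, hp]
  exact pair_counit_comul e a

/-! ### Matrix coefficients of a tensor automorphism -/

section matCoeff

variable {R : GAlg G k}

/-- The matrix coefficients of a family of automorphisms of the `R ⊗ U`. -/
def matCoeff (β : ∀ V : Rep H, (R ⊗[k] V) ≃ₗ[R] (R ⊗[k] V)) (U : Rep H) (l : U →ₗ[k] k) :
    U →ₗ[k] R :=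
  (pair R l).restrictScalars k ∘ₗ (β U).toLinearMap.restrictScalars k ∘ₗ TensorProduct.mk k R U 1

lemma matCoeff_apply (β : ∀ V : Rep H, (R ⊗[k] V) ≃ₗ[R] (R ⊗[k] V)) (U : Rep H) (l : U →ₗ[k] k)
    (w : U) : matCoeff β U l w = pair R l (β U ((1 : R) ⊗ₜ[k] w)) := rfl

/-- The functional `l ⊗ m` on `U ⊗ W`. -/
def tensorFunctional {U W : Type u} [AddCommGroup U] [Module k U] [AddCommGroup W] [Module k W]
    (l : U →ₗ[k] k) (m : W →ₗ[k] k) : U ⊗[k] W →ₗ[k] k :=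
  (TensorProduct.lid k k).toLinearMap ∘ₗ TensorProduct.map l m

lemma pair_distrib_symm {U W : Type u} [AddCommGroup U] [Module k U] [AddCommGroup W] [Module k W]
    (l : U →ₗ[k] k) (m : W →ₗ[k] k) (x : R ⊗[k] U) (y : R ⊗[k] W) :
    pair R (tensorFunctional l m)
      ((TensorProduct.AlgebraTensorModule.distribBaseChange k R U W).symm (x ⊗ₜ y)) =
      pair R l x * pair R m y := by
  induction x with
  | zero => simp
  | add x x' hx hx' => simp only [map_add, TensorProduct.add_tmul, add_mul, hx, hx']
  | tmul r v =>
    induction y with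
    | zero => simp
    | add y y' hy hy' => simp only [map_add, TensorProduct.tmul_add, mul_add, hy, hy']
    | tmul s w => simp [tensorFunctional, smul_smul, mul_comm]

/-- The functional `ᵍl` on `ᵍU`, `a ⊗ u ↦ a * g(l(u))`. -/
def twistFunctional (g : G) {U : Type u} [AddCommGroup U] [Module k U] (l : U →ₗ[k] k) :
    Twist g k U →ₗ[k] k :=
  { Twist.liftAdd g
      { toFun := fun a =>
          { toFun := fun u => a * g • l u
            map_zero' := by simp
            map_add' := fun u u' => by simp [mul_add] }
        map_zero' := by ext u; simp
        map_add' := fun a a' => by ext u; simp [add_mul] }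
      (fun a b u => by simp [smul_mul', mul_assoc]) with
    map_smul' := fun a x => by
      simp only [ZeroHom.toFun_eq_coe, AddMonoidHom.toZeroHom_coe, RingHom.id_apply]
      induction x using Twist.induction with
      | zero => simp
      | tmul b u => simp [Twist.smul_tmul, mul_assoc]
      | add x y hx hy => simp only [smul_add, map_add, hx, hy] }

@[simp] lemma twistFunctional_tmul (g : G) {U : Type u} [AddCommGroup U] [Module k U]
    (l : U →ₗ[k] k) (a : k) (u : U) :
    twistFunctional g l (Twist.tmul g a u) = a * g • l u := rfl

lemma pair_twistIsoInvAux (g : G) {U : Type u} [AddCommGroup U] [Module k U] (l : U →ₗ[k] k)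
    (x : R ⊗[k] U) :
    pair R (twistFunctional g l) (twistIsoInvAux R U g x) = g • pair R l x := by
  induction x with
  | zero => simp
  | add x y hx hy => simp only [map_add, smul_add, hx, hy]
  | tmul r v => simp [Algebra.smul_def, GAlg.smul_algebraMap]

variable {β : ∀ V : Rep H, (R ⊗[k] V) ≃ₗ[R] (R ⊗[k] V)}
lemma IsGTensorAut.matCoeff_hom (hβ : IsGTensorAut R β) {U W : Rep H} (f : U ⟶ W)
    (l : W →ₗ[k] k) (w : U) :
    matCoeff β W l (f.toLinearMap w) = matCoeff β U (l ∘ₗ f.toLinearMap) w := by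
  have h := LinearMap.congr_fun (hβ.naturality f) ((1 : R) ⊗ₜ[k] w)
  rw [LinearMap.comp_apply, LinearMap.comp_apply, LinearMap.baseChange_tmul] at h
  rw [matCoeff_apply, matCoeff_apply, ← pair_baseChange]
  exact congrArg (pair R l) h.symm

lemma IsGTensorAut.matCoeff_tensor (hβ : IsGTensorAut R β)
    (U W : Rep H) (l : U →ₗ[k] k) (m : W →ₗ[k] k) (u : U) (w : W) :
    matCoeff β (U.tensor W) (tensorFunctional l m) (u ⊗ₜ[k] w) =
      matCoeff β U l u * matCoeff β W m w := by
  have h := LinearEquiv.congr_fun (((isGTensorAut_iff R β).1 hβ).2.1 U W)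
    ((1 : R) ⊗ₜ[k] (u ⊗ₜ[k] w))
  exact (congrArg (pair R (tensorFunctional l m)) h).trans (pair_distrib_symm l m _ _)

lemma IsGTensorAut.matCoeff_unit (hβ : IsGTensorAut R β) :
    matCoeff β (Rep.unit H) (LinearMap.id : k →ₗ[k] k) (1 : k) = 1 := by
  have h := LinearEquiv.congr_fun ((isGTensorAut_iff R β).1 hβ).2.2.1 ((1 : R) ⊗ₜ[k] (1 : k))
  exact (congrArg (pair R (LinearMap.id : k →ₗ[k] k)) h).trans (one_smul k (1 : R))

/-- The twisted representation carries the `g`-translates of the coefficients of `U`; this is the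
source of the `G`-equivariance of the map `A ⟶ R`. -/
lemma IsGTensorAut.matCoeff_twist (hβ : IsGTensorAut R β) (g : G) (U : Rep H)
    (l : U →ₗ[k] k) (u : U) :
    matCoeff β (U.twist g) (twistFunctional g l) (Twist.tmul g (1 : k) u) =
      g • matCoeff β U l u := by
  have h := LinearEquiv.congr_fun (((isGTensorAut_iff R β).1 hβ).2.2.2 g U)
    ((1 : R) ⊗ₜ[k] Twist.tmul g (1 : k) u)
  refine (congrArg (pair R (twistFunctional g l))
    (h.trans (glTwist_one_tmul R U g (β U) 1 u))).trans ?_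
  rw [map_one, one_smul, pair_twistIsoInvAux]
  rfl

/-- Naturality along `IsSubcomodule.coeffHom`, under which the counit pulls back to `l` by
`Rep.counit_coeff`. An arbitrary triple `(U, l, w)` is moved to one living inside `A`. -/
lemma IsGTensorAut.matCoeff_rep (hβ : IsGTensorAut R β) {V : Submodule k A}
    (hV : IsSubcomodule e V) (hfg : V.FG) (U : Rep H) (l : U →ₗ[k] k)
    (h : ∀ w, U.coeff e l w ∈ V) (w : U) :
    matCoeff β (hV.rep hfg) (counitLin e ∘ₗ V.subtype) ⟨U.coeff e l w, h w⟩ =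
      matCoeff β U l w := by
  refine (hβ.matCoeff_hom (hV.coeffHom e hfg U l h) (counitLin e ∘ₗ V.subtype) w).trans ?_
  congr 2
  ext w
  exact U.counit_coeff e l w

lemma IsGTensorAut.matCoeff_congr (hβ : IsGTensorAut R β) {U U' : Rep H}
    {l : U →ₗ[k] k} {l' : U' →ₗ[k] k} {w : U} {w' : U'} (h : U.coeff e l w = U'.coeff e l' w') :
    matCoeff β U l w = matCoeff β U' l' w' := by
  -- One finite-dimensional subcomodule receives both coefficient maps; there the two triples become
  -- the same vector with the same functional.
  obtain ⟨V, hfg, hV, hle⟩ := exists_isSubcomodule_le e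
    (LinearMap.range (U.coeff e l) ⊔ LinearMap.range (U'.coeff e l'))
    ((Module.Finite.iff_fg.1 inferInstance).sup (Module.Finite.iff_fg.1 inferInstance))
  have h1 : ∀ w, U.coeff e l w ∈ V := fun w =>
    hle (Submodule.mem_sup_left (LinearMap.mem_range_self _ w))
  have h2 : ∀ w, U'.coeff e l' w ∈ V := fun w =>
    hle (Submodule.mem_sup_right (LinearMap.mem_range_self _ w))
  rw [← hβ.matCoeff_rep e hV hfg U l h1, ← hβ.matCoeff_rep e hV hfg U' l' h2]
  exact congrArg (matCoeff β (hV.rep hfg) _) (Subtype.ext h)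

lemma exists_coeff_eq (a : A) : ∃ (U : Rep H) (l : U →ₗ[k] k) (w : U), U.coeff e l w = a := by
  obtain ⟨V, hfg, hV, ha⟩ := exists_isSubcomodule_mem e a
  exact ⟨hV.rep hfg, counitLin e ∘ₗ V.subtype, (⟨a, ha⟩ : V), hV.coeff_rep e hfg ⟨a, ha⟩⟩

lemma exists_coeff_eq₂ (a b : A) : ∃ (U : Rep H) (l : U →ₗ[k] k) (w w' : U),
    U.coeff e l w = a ∧ U.coeff e l w' = b := by
  obtain ⟨V, hfg, hV, ha⟩ := exists_isSubcomodule_le e (Submodule.span k {a, b})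
    (Submodule.fg_span (Set.toFinite _))
  rw [Submodule.span_le, Set.insert_subset_iff, Set.singleton_subset_iff] at ha
  exact ⟨hV.rep hfg, counitLin e ∘ₗ V.subtype, (⟨a, ha.1⟩ : V), (⟨b, ha.2⟩ : V),
    hV.coeff_rep e hfg ⟨a, ha.1⟩, hV.coeff_rep e hfg ⟨b, ha.2⟩⟩

/-- An automorphism of the `G`-`⊗`-functor `V ↦ R ⊗ V` comes from a morphism `A → R`. -/
lemma IsGTensorAut.exists_hom (hβ : IsGTensorAut R β) :
    ∃ F : A ⟶ R, ∀ (U : Rep H) (l : U →ₗ[k] k) (w : U),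
      F.toAlgHom (U.coeff e l w) = matCoeff β U l w := by
  choose U l w hw using exists_coeff_eq e
  let F (a : A) : R := matCoeff β (U a) (l a) (w a)
  have hF : ∀ (U : Rep H) (l : U →ₗ[k] k) (w : U), F (U.coeff e l w) = matCoeff β U l w :=
    fun U l w => hβ.matCoeff_congr e (hw _)
  -- The universal point gives a tensor automorphism over `A` whose `matCoeff` is `coeff` by
  -- definition. Applying each `matCoeff` identity to it and to `β` realises `1`, products and the
  -- `G`-action in `A` and in `R` by the same representations.
  have hgen := isGTensorAut_act A (generic e)
  have hone : F 1 = 1 := by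
    have h1 : (1 : A) = (Rep.unit H).coeff e (LinearMap.id : k →ₗ[k] k) (1 : k) :=
      hgen.matCoeff_unit.symm
    rw [h1]
    exact (hF _ _ _).trans hβ.matCoeff_unit
  have hmul : ∀ a b, F (a * b) = F a * F b := fun a b => by
    obtain ⟨U, l, u, rfl⟩ := exists_coeff_eq e a
    obtain ⟨W, m, w, rfl⟩ := exists_coeff_eq e b
    have h1 : U.coeff e l u * W.coeff e m w =
        (U.tensor W).coeff e (tensorFunctional l m) (u ⊗ₜ[k] w) :=
      (hgen.matCoeff_tensor U W l m u w).symm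
    rw [h1, hF, hF]
    exact (hF _ _ _).trans (hβ.matCoeff_tensor U W l m u w)
  have hadd : ∀ a b, F (a + b) = F a + F b := fun a b => by
    -- With a common representation and functional, additivity is linearity in the vector.
    obtain ⟨U, l, u, w, rfl, rfl⟩ := exists_coeff_eq₂ e a b
    rw [← map_add, hF, hF, hF, map_add]
  have hsmul : ∀ (c : k) (a : A), F (c • a) = c • F a := fun c a => by
    obtain ⟨U, l, u, rfl⟩ := exists_coeff_eq e a
    rw [← map_smul, hF, hF, map_smul]
  have hact : ∀ (g : G) (a : A), F (g • a) = g • F a := fun g a => by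
    obtain ⟨U, l, u, rfl⟩ := exists_coeff_eq e a
    have h1 : g • U.coeff e l u =
        (U.twist g).coeff e (twistFunctional g l) (Twist.tmul g (1 : k) u) :=
      (hgen.matCoeff_twist g U l u).symm
    rw [h1, hF]
    exact (hF _ _ _).trans (hβ.matCoeff_twist g U l u)
  exact ⟨GAlg.Hom.mk (AlgHom.ofLinearMap
    { toFun := F, map_add' := hadd, map_smul' := hsmul } hone hmul) hact, hF⟩

end matCoeff

/-! ### Bijectivity of the canonical morphism -/

lemma canonical_app_injective (e : (H ⋙ forget GrpCat.{u}).CorepresentableBy A) (R : GAlg G k) :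
    Function.Injective ((canonical H).app R) := by
  intro h h' hh
  have hact : ∀ U : Rep H, U.act R h.down = U.act R h'.down :=
    fun U => congrFun (congrArg Subtype.val hh) U
  have hf : classify e h.down = classify e h'.down := GAlg.hom_ext fun a => by
    obtain ⟨U, l, w, rfl⟩ := exists_coeff_eq e a
    rw [← U.pair_act, ← U.pair_act, hact]
  apply ULift.down_injective
  rw [← map_classify e h.down, hf, map_classify]

lemma canonical_app_surjective (e : (H ⋙ forget GrpCat.{u}).CorepresentableBy A) (R : GAlg G k) :
    Function.Surjective ((canonical H).app R) := by
  rintro ⟨β, hβ⟩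
  obtain ⟨F, hF⟩ := IsGTensorAut.exists_hom e hβ
  refine ⟨ULift.up (H.map F (generic e)), Subtype.ext (funext fun U => ?_)⟩
  -- It suffices to compare matrix coefficients of `β` and of the point classified by `F`, and these
  -- agree by the choice of `F`.
  refine LinearEquiv.toLinearMap_injective (linearMap_ext fun w => pair_ext fun l => ?_)
  have hc : classify e (H.map F (generic e)) = F := generic_ext e (map_classify e _)
  refine (U.pair_act e l (H.map F (generic e)) w).trans ?_
  rw [hc, hF]
  rfl

end GTannaka

end

theorem proposition3p14 {G : Type v} [Monoid G] {k : Type u} [Field k] [MulSemiringAction G k]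
    (H : GTannaka.GAlg.{u, v} G k ⥤ GrpCat.{u}) (hH : GTannaka.IsGroupScheme H) :
    IsIso (GTannaka.canonical H) := by
  obtain ⟨A, ⟨e⟩⟩ := hH.has_corepresentation
  have (R : GTannaka.GAlg G k) : IsIso ((GTannaka.canonical H).app R) :=
    (ConcreteCategory.isIso_iff_bijective _).2
      ⟨GTannaka.canonical_app_injective e R, GTannaka.canonical_app_surjective e R⟩
  exact NatIso.isIso_of_isIso_app _
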